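/- Let $K$ be a field of characteristic $0$ (for instance $\mathbb R$ or $\mathbb C$), let $V$ be a finite-dimensional $K$-vector space with basis $e_1,\dots,e_n$ and dual coordinates $z_1,\dots,z_n$. *Crossed module.* Let $\mathfrak k_0=\mathrm{FL}(V)\subset T(V)$ be the free Lie algebra (the primitive elements of the tensor algebra) and $\mathfrak k_1=(T(V)\otimes\Lambda^2V)/\mathrm{Pf}$, where $\delta\big((x_1\cdots x_k)\otimes(u\wedge v)\big)=[x_1,\dots[x_k,[u,v]]\dots]$, $x\triangleright(a\otimes w)=xa\otimes w$, and $\mathrm{Pf}$ is the span of all $\delta(X)\triangleright Y+\delta(Y)\triangleright X$. Then $\delta:\mathfrak k_1\to\mathfrak k_0$ with $\triangleright$ and $[X,Y]=\delta(X)\triangleright Y$ is the free crossed module of Lie algebras on $\Lambda^2V\to\mathfrak k_0$, $u\wedge v\mapsto[u,v]$. Put $\mathfrak a_1=\ker\delta$; a bracket $[x,E]$ with $x\in\mathfrak k_0$, $E\in\mathfrak k_1$ means $x\triangleright E$. *Forms.* Forms are formal (power series in $z_1,\dots,z_n$); $\widehat\Omega^m$ denotes the formal $m$-forms and $\Omega^m$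 the polynomial ones. A vector-valued form is a power series whose coefficients are constant-coefficient vector-valued forms. *Abelianization.* A 2-connection is a pair $(\gamma_0,\gamma_1)$ of a $\mathfrak k_0$-valued 1-form and a $\mathfrak k_1$-valued 2-form; its 2-curvature is $\mathcal K^{\gamma_0,\gamma_1}=d\gamma_1+\gamma_0\wedge^{\triangleright}\gamma_1$. The universal 2-connection is $\zeta_0=\sum_i dz_i\,e_i$, $\zeta_1=\sum_{i<j}dz_i\wedge dz_j\,(e_i\wedge e_j)$. Gauge transformations act by $\theta\cdot(\gamma_0,\gamma_1)=(\theta\,d(\theta^{-1})+\theta\gamma_0\theta^{-1},\ \theta\triangleright\gamma_1)$ and $\Theta\cdot(\gamma_0,\gamma_1)=(\gamma_0+\delta\Theta,\ \gamma_1+d\Theta+\gamma_0\wedge^{\triangleright}\Theta+\tfrac12[\Theta,\Theta])$, and $(\theta,\Theta)\cdot(\gamma_0,\gamma_1)=\Theta\cdot(\theta\cdot(\gamma_0,\gamma_1))$. Let $$\eta=\sum_i z_ie_i,\quad \theta=\exp(\eta),\quad U=\sum_{i<j}(e_i\wedge e_j)(z_i\,dz_j-z_j\,dz_i),\quad \Theta=-\sum_{k\ge0}\frac{k+1}{(k+2)!}\,\mathrm{ad}_\eta^k\,U,$$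 where $\mathrm{ad}_\eta=\eta\,\triangleright$, let $(\gamma_0^{\mathrm{ab}},\zeta_1^{\mathrm{ab}})=(\theta,\Theta)\cdot(\zeta_0,\zeta_1)$, and let $\mathcal K^{\mathrm{ab}}$ be its 2-curvature. *Currents.* Let $\rho:\mathfrak k_1\to\Gamma_2=S(V)\otimes\Lambda^2V$ be induced by the symmetrization map $T(V)\otimes\Lambda^2V\to S(V)\otimes\Lambda^2V$. For $\xi\in\Omega^2$ put $\langle u_1\cdots u_r\otimes v_1\wedge v_2,\xi\rangle=(L_{u_1}\cdots L_{u_r}\iota_{v_1}\iota_{v_2}\xi)|_{0}$, and for $\omega=d\xi$, $\xi\in\Omega^2$, put $\langle a,\omega\rangle_{\mathrm{cl}}=-\langle a,\xi\rangle$ (for $a\in\rho(\mathfrak a_1)$ this depends only on $\omega$). Every closed $\omega\in\Omega^{3,\mathrm{cl}}$ is of this form. For an $\mathfrak a_1$-valued closed formal 3-form $X$, let $\hat\rho(X)$ send $\omega\in\Omega^{3,\mathrm{cl}}$ to the 3-form obtained by applying $\langle\rho(\cdot),\omega\rangle_{\mathrm{cl}}$ to the values of $X$. *Explicit elements.* For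 $\mathbf q=(q_1,\dots,q_r)$, $r\ge0$, and $q_1\ge\dots\ge q_r\ge i<j<k$ let $$B_{ijk}=[e_i,e_j\wedge e_k]-[e_j,e_i\wedge e_k]+[e_k,e_i\wedge e_j],\quad B_{\mathbf q,ijk}=[e_{q_1},\dots[e_{q_r},B_{ijk}]\dots],\quad \omega_{\mathbf q,ijk}=\frac{z^\alpha}{\alpha!}\,dz_j\wedge dz_k,$$ where $\alpha_s$ is the number of times $s$ occurs in $(\mathbf q,i)$. **Theorem.** The transformed 2-connection is abelian: $\gamma_0^{\mathrm{ab}}=0$ and $\zeta_1^{\mathrm{ab}}$ has values in $\mathfrak a_1$. The abelianized 2-curvature $\mathcal K^{\mathrm{ab}}$ is a closed form with values in $\mathfrak a_1$, and $$\hat\rho(\mathcal K^{\mathrm{ab}})=\mathrm{id}\in\mathrm{End}(\Omega^{3,\mathrm{cl}}),$$ where for each $\omega\in\Omega^{3,\mathrm{cl}}$ the value $\hat\rho(\mathcal K^{\mathrm{ab}})(\omega)$ may be computed with any primitive $\xi\in\Omega^2$ of $\omega$. Explicitly, $$\mathcal K^{\mathrm{ab}}=\sum_{q_1\ge\dots\ge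 q_r\ge i<j<k}B_{\mathbf q,ijk}\otimes d(\omega_{\mathbf q,ijk}),$$ where only finitely many terms contribute to each coefficient of the formal form. -/

import Mathlib

open scoped TensorProduct

noncomputable section

namespace UniversalTwoConnection

/-! ### The free crossed module of Lie algebras `δ : 𝔨₁(V) → 𝔨₀(V)` -/

section CrossedModule

variable (K V : Type*) [Field K] [AddCommGroup V] [Module K V]

/-- The shuffle coproduct of the tensor algebra: the algebra map with `v ↦ v ⊗ 1 + 1 ⊗ v`. -/
def coproduct : TensorAlgebra K V →ₐ[K] TensorAlgebra K V ⊗[K] TensorAlgebra K V :=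
  TensorAlgebra.lift K
    (Algebra.TensorProduct.includeLeft.toLinearMap ∘ₗ TensorAlgebra.ι K +
      Algebra.TensorProduct.includeRight.toLinearMap ∘ₗ TensorAlgebra.ι K)

/-- The free Lie algebra `𝔨₀(V) = FL(V)`: the primitive elements of the tensor algebra `T(V)`. -/
def K0 : Submodule K (TensorAlgebra K V) :=
  LinearMap.eqLocus (coproduct K V).toLinearMap
    ((Algebra.TensorProduct.includeLeft : TensorAlgebra K V →ₐ[K] _).toLinearMap +
      (Algebra.TensorProduct.includeRight : TensorAlgebra K V →ₐ[K] _).toLinearMap)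

/-- The free `𝔨₀`-representation `U(𝔨₀) ⊗ Λ²V = T(V) ⊗ Λ²V`; here `x ∈ 𝔨₀ ⊆ T(V)` acts through
the left `T(V)`-module structure, `x ▷ (a ⊗ w) = x a ⊗ w`. -/
abbrev FreeRep : Type _ := TensorAlgebra K V ⊗[K] (⋀[K]^2 V)

variable {K V}

/-- The adjoint action `[x, ·]` of `x` on the associative algebra `T(V)`. -/
def commutator (x : TensorAlgebra K V) : Module.End K (TensorAlgebra K V) :=
  LinearMap.mulLeft K x - LinearMap.mulRight K x

theorem commutator_apply (x y : TensorAlgebra K V) : commutator x y = x * y - y * x := by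
  simp [commutator]

variable (K V)

/-- The action of `T(V) = U(𝔨₀)` that extends the adjoint action:
`v₁ ⋯ v_k` sends `x` to `[v₁, … [v_k, x] … ]`. -/
def adjointAction : TensorAlgebra K V →ₐ[K] Module.End K (TensorAlgebra K V) :=
  TensorAlgebra.lift K
    { toFun := fun v => commutator (TensorAlgebra.ι K v)
      map_add' := fun v w => by ext1 x; simp [commutator_apply, add_mul, mul_add]; abel
      map_smul' := fun c v => by ext1 x; simp [commutator_apply, smul_sub] }

/-- The linear map `s : Λ²V → T(V)`, `u ∧ v ↦ [u, v] = u v - v u`. -/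
def wedgeToCommutator : ⋀[K]^2 V →ₗ[K] TensorAlgebra K V :=
  exteriorPower.alternatingMapLinearEquiv
    (AlternatingMap.alternatizeUncurryFin
      { toFun := fun u => AlternatingMap.ofSubsingleton K V (TensorAlgebra K V) (0 : Fin 1)
          (LinearMap.mulLeft K (TensorAlgebra.ι K u) ∘ₗ TensorAlgebra.ι K)
        map_add' := fun u v => by ext1 x; simp [add_mul]
        map_smul' := fun c v => by ext1 x; simp })

theorem wedgeToCommutator_apply (u v : V) :
    wedgeToCommutator K V (exteriorPower.ιMulti K 2 ![u, v]) =
      TensorAlgebra.ι K u * TensorAlgebra.ι K v - TensorAlgebra.ι K v * TensorAlgebra.ι K u := by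
  simp [wedgeToCommutator, AlternatingMap.alternatizeUncurryFin_apply, Fin.sum_univ_two,
    Fin.removeNth, sub_eq_add_neg]

/-- `δ` on the free representation: `(x₁ ⋯ x_k) ⊗ w ↦ [x₁, … [x_k, s(w)] … ]`. -/
def deltaFree : FreeRep K V →ₗ[K] TensorAlgebra K V :=
  TensorProduct.lift ((adjointAction K V).toLinearMap.compl₂ (wedgeToCommutator K V))

theorem deltaFree_tmul (a : TensorAlgebra K V) (w : ⋀[K]^2 V) :
    deltaFree K V (a ⊗ₜ w) = adjointAction K V a (wedgeToCommutator K V w) := rfl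

variable {K V}

theorem adjointAction_ι (v : V) :
    adjointAction K V (TensorAlgebra.ι K v) = commutator (TensorAlgebra.ι K v) := by
  simp [adjointAction]

theorem adjointAction_mem (p : Submodule K (TensorAlgebra K V))
    (hp : ∀ v : V, ∀ x ∈ p, commutator (TensorAlgebra.ι K v) x ∈ p)
    (a : TensorAlgebra K V) : ∀ x ∈ p, adjointAction K V a x ∈ p := by
  induction a using TensorAlgebra.induction with
  | algebraMap r => intro x hx; simpa [Algebra.algebraMap_eq_smul_one] using p.smul_mem r hx
  | ι v => intro x hx; rw [adjointAction_ι]; exact hp v x hx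
  | mul a b ha hb => intro x hx; rw [map_mul]; exact ha _ (hb _ hx)
  | add a b ha hb => intro x hx; rw [map_add]; exact p.add_mem (ha _ hx) (hb _ hx)

theorem wedgeToCommutator_mem (p : Submodule K (TensorAlgebra K V))
    (hp : ∀ u v : V, commutator (TensorAlgebra.ι K u) (TensorAlgebra.ι K v) ∈ p)
    (w : ⋀[K]^2 V) : wedgeToCommutator K V w ∈ p := by
  have hw : w ∈ Submodule.span K (Set.range (exteriorPower.ιMulti K 2 (M := V))) := by
    rw [exteriorPower.ιMulti_span]; trivial
  induction hw using Submodule.span_induction with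
  | mem x hx =>
    obtain ⟨f, rfl⟩ := hx
    have hf : f = ![f 0, f 1] := by ext i; fin_cases i <;> rfl
    rw [hf, wedgeToCommutator_apply, ← commutator_apply]
    exact hp _ _
  | zero => simp
  | add x y _ _ hx hy => rw [map_add]; exact p.add_mem hx hy
  | smul c x _ hx => rw [map_smul]; exact p.smul_mem c hx

theorem deltaFree_mem (p : Submodule K (TensorAlgebra K V))
    (h1 : ∀ u v : V, commutator (TensorAlgebra.ι K u) (TensorAlgebra.ι K v) ∈ p)
    (h2 : ∀ v : V, ∀ x ∈ p, commutator (TensorAlgebra.ι K v) x ∈ p)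
    (X : FreeRep K V) : deltaFree K V X ∈ p := by
  induction X using TensorProduct.induction_on with
  | zero => simp
  | tmul a w =>
    rw [deltaFree_tmul]
    exact adjointAction_mem p h2 a _ (wedgeToCommutator_mem p h1 w)
  | add x y hx hy => rw [map_add]; exact p.add_mem hx hy

theorem mem_K0 (x : TensorAlgebra K V) :
    x ∈ K0 K V ↔ coproduct K V x = x ⊗ₜ[K] 1 + 1 ⊗ₜ[K] x := by
  simp [K0, LinearMap.mem_eqLocus]

theorem ι_mem_K0 (v : V) : TensorAlgebra.ι K v ∈ K0 K V := by
  rw [mem_K0]; simp [coproduct]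

/-- The primitive elements are closed under the commutator. -/
theorem commutator_mem_K0 {x y : TensorAlgebra K V} (hx : x ∈ K0 K V) (hy : y ∈ K0 K V) :
    commutator x y ∈ K0 K V := by
  rw [mem_K0] at *
  rw [commutator_apply, map_sub, map_mul, map_mul, hx, hy]
  simp only [mul_add, add_mul, Algebra.TensorProduct.tmul_mul_tmul, mul_one, one_mul,
    TensorProduct.sub_tmul, TensorProduct.tmul_sub]
  abel

theorem deltaFree_mem_K0 (X : FreeRep K V) : deltaFree K V X ∈ K0 K V :=
  deltaFree_mem _ (fun u v => commutator_mem_K0 (ι_mem_K0 u) (ι_mem_K0 v))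
    (fun v _ hx => commutator_mem_K0 (ι_mem_K0 v) hx) X

theorem adjointAction_deltaFree (X : FreeRep K V) :
    adjointAction K V (deltaFree K V X) = commutator (deltaFree K V X) := by
  let p : Submodule K (TensorAlgebra K V) :=
    LinearMap.eqLocus (adjointAction K V).toLinearMap
      (LinearMap.mul K (TensorAlgebra K V) - (LinearMap.mul K (TensorAlgebra K V)).flip)
  have hmem : ∀ x, x ∈ p ↔ adjointAction K V x = commutator x := by
    intro x; exact Iff.rfl
  have hι : ∀ v : V, TensorAlgebra.ι K v ∈ p := fun v => (hmem _).2 (adjointAction_ι v)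
  have hc : ∀ v : V, ∀ x ∈ p, commutator (TensorAlgebra.ι K v) x ∈ p := by
    intro v x hx
    rw [hmem] at *
    rw [commutator_apply, map_sub, map_mul, map_mul, hx, adjointAction_ι]
    ext1 y
    simp only [LinearMap.sub_apply, Module.End.mul_apply, commutator_apply]
    noncomm_ring
  exact (hmem _).1 (deltaFree_mem p (fun u v => hc u _ (hι v)) hc X)

theorem deltaFree_smul (a : TensorAlgebra K V) (X : FreeRep K V) :
    deltaFree K V (a • X) = adjointAction K V a (deltaFree K V X) := by
  induction X using TensorProduct.induction_on with
  | zero => simp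
  | tmul b w => rw [TensorProduct.smul_tmul']; simp [deltaFree_tmul]
  | add x y hx hy => rw [smul_add, map_add, hx, hy, map_add, map_add]

variable (K V)

/-- The Peiffer subspace: the `K`-span of the elements `δ(X) ▷ Y + δ(Y) ▷ X`. -/
def peifferSpan : Submodule K (FreeRep K V) :=
  Submodule.span K {Z | ∃ X Y : FreeRep K V, Z = deltaFree K V X • Y + deltaFree K V Y • X}

variable {K V}

theorem smul_mem_peifferSpan (a : TensorAlgebra K V) :
    ∀ Z ∈ peifferSpan K V, a • Z ∈ peifferSpan K V := by
  induction a using TensorAlgebra.induction with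
  | algebraMap r => intro Z hZ; rw [algebraMap_smul]; exact Submodule.smul_mem _ r hZ
  | mul a b ha hb => intro Z hZ; rw [mul_smul]; exact ha _ (hb _ hZ)
  | add a b ha hb => intro Z hZ; rw [add_smul]; exact Submodule.add_mem _ (ha _ hZ) (hb _ hZ)
  | ι v =>
    intro Z hZ
    induction hZ using Submodule.span_induction with
    | mem Z hZ =>
      obtain ⟨X, Y, rfl⟩ := hZ
      have key : TensorAlgebra.ι K v • (deltaFree K V X • Y + deltaFree K V Y • X) =
          (deltaFree K V (TensorAlgebra.ι K v • X) • Y +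
            deltaFree K V Y • (TensorAlgebra.ι K v • X)) +
          (deltaFree K V X • (TensorAlgebra.ι K v • Y) +
            deltaFree K V (TensorAlgebra.ι K v • Y) • X) := by
        have hs : ∀ (c e : TensorAlgebra K V) (Z : FreeRep K V),
            (c * e - e * c) • Z = c • e • Z - e • c • Z := fun c e Z => by
          rw [← mul_smul, ← mul_smul]; exact sub_smul (c * e) (e * c) Z
        simp only [deltaFree_smul, adjointAction_ι, commutator_apply, smul_add, hs]
        abel
      rw [key]
      exact Submodule.add_mem _ (Submodule.subset_span ⟨_, _, rfl⟩)
        (Submodule.subset_span ⟨_, _, rfl⟩)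
    | zero => simp
    | add x y _ _ hx hy => rw [smul_add]; exact Submodule.add_mem _ hx hy
    | smul c x _ hx => rw [smul_comm]; exact Submodule.smul_mem _ c hx

variable (K V)

/-- The Peiffer subspace is stable under `𝔨₀`, hence a `T(V)`-submodule. -/
def peiffer : Submodule (TensorAlgebra K V) (FreeRep K V) :=
  { (peifferSpan K V) with smul_mem' := fun a _ hZ => smul_mem_peifferSpan a _ hZ }

/-- `𝔨₁(V) = (T(V) ⊗ Λ²V) / Pf`. The action `▷` of `𝔨₀ ⊆ T(V)` is the scalar multiplication of
the `T(V)`-module `𝔨₁`. -/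
abbrev K1 : Type _ := FreeRep K V ⧸ peiffer K V

/-- A `K`-linear map on `T(V) ⊗ Λ²V` that kills the Peiffer elements descends to `𝔨₁`. -/
def descend {N : Type*} [AddCommGroup N] [Module K N] (f : FreeRep K V →ₗ[K] N)
    (hf : ∀ X Y : FreeRep K V, f (deltaFree K V X • Y + deltaFree K V Y • X) = 0) :
    K1 K V →ₗ[K] N :=
  ((peiffer K V).restrictScalars K).liftQ f
      (by
        change peifferSpan K V ≤ _
        rw [peifferSpan, Submodule.span_le]
        rintro _ ⟨X, Y, rfl⟩
        exact hf X Y) ∘ₗ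
    (Submodule.Quotient.restrictScalarsEquiv K (peiffer K V)).symm.toLinearMap

/-- The boundary map `δ : 𝔨₁(V) → 𝔨₀(V)` of the free crossed module. -/
def delta : K1 K V →ₗ[K] K0 K V :=
  descend K V ((deltaFree K V).codRestrict (K0 K V) deltaFree_mem_K0) (fun X Y => by
    apply Subtype.ext
    change deltaFree K V (deltaFree K V X • Y + deltaFree K V Y • X) = 0
    simp only [map_add, deltaFree_smul, adjointAction_deltaFree, commutator_apply]
    abel)

/-- `𝔞₁(V) = ker δ`. -/
def A1 : Submodule K (K1 K V) := LinearMap.ker (delta K V)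

variable {K V}

/-- The generator `u ∧ v ∈ Λ²V ⊆ 𝔨₁(V)`. -/
def gen : V [⋀^Fin 2]→ₗ[K] K1 K V :=
  ((peiffer K V).mkQ.restrictScalars K ∘ₗ
    TensorProduct.mk K (TensorAlgebra K V) (⋀[K]^2 V) 1).compAlternatingMap
      (exteriorPower.ιMulti K 2)

end CrossedModule

/-! ### Formal differential forms with values in a vector space

With a basis `b` of `V` and the dual coordinates `z₁, …, zₙ`, a formal `m`-form with values in `M`
is a formal power series in `z₁, …, zₙ` whose coefficients are constant-coefficient `m`-forms with
values in `M`. For `M = K` this is the completion `Ω̂^m(V) = ∏_r S^{r-m}(V*) ⊗ Λ^m(V*)`, and for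
general `M` it is `M ⊗̂ Ω̂^m(V)`. All `𝔨₁`-valued forms below are homogeneous for the weights of `𝔨₁`
and of forms simultaneously, so each coefficient lies in `𝔨₁` itself and completing in the form
direction is enough; an identity between such forms holds a fortiori in the completion of `𝔨₁`. -/

section Forms

variable {K V : Type*} [Field K] [AddCommGroup V] [Module K V] {n : ℕ}

/-- Formal power series in `z₁, …, zₙ` with coefficients in `M`. -/
abbrev Ser (n : ℕ) (M : Type*) : Type _ := MvPowerSeries (Fin n) M

/-- Formal `m`-forms on `V` with values in `M`. -/
abbrev Form (K V : Type*) [Field K] [AddCommGroup V] [Module K V] (n m : ℕ)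
    (M : Type*) [AddCommGroup M] [Module K M] : Type _ := Ser n (V [⋀^Fin m]→ₗ[K] M)

section General

variable {M : Type*} [AddCommGroup M] [Module K M]

/-- The series `z^α x`. -/
def mono (α : Fin n →₀ ℕ) (x : M) : Ser n M := fun β => if β = α then x else 0

/-- The partial derivative `∂/∂zᵢ`. -/
def pderiv (K : Type*) [Field K] {n : ℕ} {M : Type*} [AddCommGroup M] [Module K M] (i : Fin n) :
    Ser n M →ₗ[K] Ser n M where
  toFun f := fun α => (α i + 1) • f (α + Finsupp.single i 1)
  map_add' f g := by funext α; exact smul_add _ _ _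
  map_smul' c f := by funext α; exact smul_comm _ _ _

/-- The Lie derivative `L_v = ∑ᵢ zᵢ(v) ∂/∂zᵢ` along the constant vector field `v`. -/
def lieDeriv (b : Module.Basis (Fin n) K V) : V →ₗ[K] Ser n M →ₗ[K] Ser n M :=
  ∑ i, (b.coord i).smulRight (pderiv K i)

/-- The differential of an `M`-valued function, as a `1`-form. -/
def dFun (b : Module.Basis (Fin n) K V) (f : Ser n M) : Form K V n 1 M := fun α =>
  AlternatingMap.ofSubsingleton K V M (0 : Fin 1)
    (LinearMap.proj (R := K) (φ := fun _ : Fin n →₀ ℕ => M) α ∘ₗ (lieDeriv b).flip f)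

/-- The exterior derivative,
`(dω)(v₀, …, v_m) = ∑ᵢ (-1)^i L_{vᵢ}(ω)(v₀, …, v̂ᵢ, …, v_m)` on constant vector fields. -/
def d (b : Module.Basis (Fin n) K V) {m : ℕ} (ω : Form K V n m M) : Form K V n (m + 1) M :=
  fun α => AlternatingMap.alternatizeUncurryFin
    (LinearMap.proj (R := K) (φ := fun _ : Fin n →₀ ℕ => V [⋀^Fin m]→ₗ[K] M) α ∘ₗ
      (lieDeriv b).flip ω)

/-- Apply a linear map to the values of a form. -/
def mapForm {N : Type*} [AddCommGroup N] [Module K N] {m : ℕ} (f : M →ₗ[K] N)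
    (ω : Form K V n m M) : Form K V n m N := fun α => f.compAlternatingMap (ω α)

/-- `x ⊗ ω` for `x ∈ M` and a scalar form `ω`. -/
def tensorForm {m : ℕ} (x : M) (ω : Form K V n m K) : Form K V n m M :=
  mapForm (LinearMap.toSpanSingleton K M x) ω

variable {A : Type*} [Ring A] [Algebra K A] [Module A M] [IsScalarTower K A M]

/-- The product of a series with values in an algebra `A` with a series with values in an
`A`-module. -/
def act {N : Type*} [AddCommGroup N] [Module A N] (f : Ser n A) (g : Ser n N) : Ser n N :=
  fun α => ∑ p ∈ Finset.HasAntidiagonal.antidiagonal α, f p.1 • g p.2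

/-- The product `ω f` of an `A`-valued form with an `A`-valued function on the right. -/
def rightMul {m : ℕ} (ω : Form K V n m A) (f : Ser n A) : Form K V n m A :=
  fun α => ∑ p ∈ Finset.HasAntidiagonal.antidiagonal α, (LinearMap.mulRight K (f p.2)).compAlternatingMap (ω p.1)

/-- The wedge product of constant forms induced by the action of `A` on `M`:
`(γ ∧ ω)(v₀, …, v_m) = ∑ᵢ (-1)^i γ(vᵢ) • ω(v₀, …, v̂ᵢ, …, v_m)`. -/
def constWedge {m : ℕ} (γ : V [⋀^Fin 1]→ₗ[K] A) (ω : V [⋀^Fin m]→ₗ[K] M) :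
    V [⋀^Fin (m + 1)]→ₗ[K] M :=
  AlternatingMap.alternatizeUncurryFin
    { toFun := fun v => γ (fun _ => v) • ω
      map_add' := fun u v => by
        have h := ((AlternatingMap.ofSubsingleton K V A (0 : Fin 1)).symm γ).map_add u v
        rw [← add_smul]; exact congrArg (· • ω) h
      map_smul' := fun c v => by
        have h := ((AlternatingMap.ofSubsingleton K V A (0 : Fin 1)).symm γ).map_smul c v
        refine (congrArg (· • ω) h).trans ?_
        ext1 x; exact smul_assoc c _ _ }

/-- The wedge product `γ ∧^▷ ω` of a `1`-form with values in `A` and an `m`-form with values in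
`M`. -/
def wedge {m : ℕ} (γ : Form K V n 1 A) (ω : Form K V n m M) : Form K V n (m + 1) M :=
  fun α => ∑ p ∈ Finset.HasAntidiagonal.antidiagonal α, constWedge (γ p.1) (ω p.2)

variable (K) in
/-- `exp(f) = ∑_k f^k / k!`, for a series `f` without constant term: then `f^k` has no term of
degree less than `k`, and only `k ≤ |α|` contribute to the coefficient of `z^α`. -/
def expSer (f : Ser n A) : Ser n A := fun α =>
  ∑ k ∈ Finset.range (α.degree + 1), ((k.factorial : K)⁻¹) • (f ^ k) α

end General

/-! ### Two-connections and gauge transformations -/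

section Gauge

/-- A 2-connection `(γ₀, γ₁)` on `V` with values in `𝔨(V)`; the form `γ₀` with values in `𝔨₀` is
regarded as a form with values in `T(V) ⊇ 𝔨₀`. -/
abbrev TwoConnection (K V : Type*) [Field K] [AddCommGroup V] [Module K V] (n : ℕ) : Type _ :=
  Form K V n 1 (TensorAlgebra K V) × Form K V n 2 (K1 K V)

/-- `δ` applied to the values of a form. -/
def deltaForm {m : ℕ} (ω : Form K V n m (K1 K V)) : Form K V n m (TensorAlgebra K V) :=
  mapForm ((K0 K V).subtype ∘ₗ delta K V) ω

/-- The 2-curvature `𝒦 = dγ₁ + γ₀ ∧^▷ γ₁`. -/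
def twoCurvature (b : Module.Basis (Fin n) K V) (γ : TwoConnection K V n) :
    Form K V n 3 (K1 K V) :=
  d b γ.2 + wedge γ.1 γ.2

/-- The bracket `[Θ, Ψ]` of `𝔨₁`-valued `1`-forms, `(X, Y) ↦ [Θ(X), Ψ(Y)] - [Θ(Y), Ψ(X)]`, where
the Lie bracket of `𝔨₁` is `[E, F] = δ(E) ▷ F`. -/
def bracketForm (Θ Ψ : Form K V n 1 (K1 K V)) : Form K V n 2 (K1 K V) :=
  wedge (deltaForm Θ) Ψ

/-- The gauge action of a function `θ` with values in the group of formal exponentials: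
`(γ₀, γ₁) ↦ (θ d(θ⁻¹) + θ γ₀ θ⁻¹, θ ▷ γ₁)`. -/
def gaugeZero (b : Module.Basis (Fin n) K V) (θ : Ser n (TensorAlgebra K V))
    (γ : TwoConnection K V n) : TwoConnection K V n :=
  (act θ (dFun b (Ring.inverse θ)) + rightMul (act θ γ.1) (Ring.inverse θ), act θ γ.2)

/-- The gauge action of a `𝔨₁`-valued `1`-form `Θ`:
`(γ₀, γ₁) ↦ (γ₀ + δΘ, γ₁ + dΘ + γ₀ ∧^▷ Θ + ½ [Θ, Θ])`. -/
def gaugeOne (b : Module.Basis (Fin n) K V) (Θ : Form K V n 1 (K1 K V))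
    (γ : TwoConnection K V n) : TwoConnection K V n :=
  (γ.1 + deltaForm Θ, γ.2 + d b Θ + wedge γ.1 Θ + (2⁻¹ : K) • bracketForm Θ Θ)

/-- The universal translation-invariant 2-connection `ζ₀ = id_V`, `ζ₁ = id_{Λ²V}`. -/
def universalConnection (K V : Type*) [Field K] [AddCommGroup V] [Module K V] (n : ℕ) :
    TwoConnection K V n :=
  (mono 0 (AlternatingMap.ofSubsingleton K V (TensorAlgebra K V) (0 : Fin 1) (TensorAlgebra.ι K)),
    mono 0 gen)

/-- `η = ∑ᵢ zᵢ eᵢ`. -/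
def eta (b : Module.Basis (Fin n) K V) : Ser n (TensorAlgebra K V) :=
  ∑ i, mono (Finsupp.single i 1) (TensorAlgebra.ι K (b i))

/-- The constant `1`-form `dzᵢ`. -/
def dz (b : Module.Basis (Fin n) K V) (i : Fin n) : V [⋀^Fin 1]→ₗ[K] K :=
  AlternatingMap.ofSubsingleton K V K (0 : Fin 1) (b.coord i)

/-- `U = ∑_{i<j} (eᵢ ∧ eⱼ) (zᵢ dzⱼ - zⱼ dzᵢ)`. -/
def formU (b : Module.Basis (Fin n) K V) : Form K V n 1 (K1 K V) :=
  ∑ i, ∑ j, if i < j then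
    tensorForm (gen ![b i, b j])
      (mono (Finsupp.single i 1) (dz b j) - mono (Finsupp.single j 1) (dz b i))
  else 0

/-- `θ = exp(η)`. -/
def theta (b : Module.Basis (Fin n) K V) : Ser n (TensorAlgebra K V) := expSer K (eta b)

/-- `Θ = -∑_k (k+1)/(k+2)! ad_η^k U`; as `ad_η^k U` is homogeneous of degree `k + 1` in `z`, only
`k ≤ |α|` contribute to the coefficient of `z^α`. -/
def bigTheta (b : Module.Basis (Fin n) K V) : Form K V n 1 (K1 K V) := fun α =>
  -∑ k ∈ Finset.range (α.degree + 1),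
    (((k : K) + 1) / ((k + 2).factorial : K)) • ((act (eta b))^[k] (formU b)) α

/-- The gauge transform `(θ, Θ) · (ζ₀, ζ₁)` of the universal 2-connection (first `θ`, then `Θ`). -/
def abelianized (b : Module.Basis (Fin n) K V) : TwoConnection K V n :=
  gaugeOne b (bigTheta b) (gaugeZero b (theta b) (universalConnection K V n))

/-- The abelianized 2-curvature `𝒦^ab`. -/
def Kab (b : Module.Basis (Fin n) K V) : Form K V n 3 (K1 K V) := twoCurvature b (abelianized b)

end Gauge

/-! ### Currents and the identification of `𝔞₁` with functionals on closed `3`-forms -/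

section Currents

theorem lieDeriv_commute {M : Type*} [AddCommGroup M] [Module K M]
    (b : Module.Basis (Fin n) K V) (u v : V) :
    Commute (lieDeriv (M := M) b u) (lieDeriv b v) := by
  have h : ∀ i j : Fin n, Commute (pderiv K (M := M) i) (pderiv K j) := by
    intro i j
    rcases eq_or_ne i j with rfl | hij
    · exact Commute.refl _
    · refine LinearMap.ext fun f => funext fun α => ?_
      change (α i + 1) • ((α + Finsupp.single i 1 : Fin n →₀ ℕ) j + 1) • f _ =
        (α j + 1) • ((α + Finsupp.single j 1 : Fin n →₀ ℕ) i + 1) • f _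
      rw [add_right_comm, smul_comm]
      simp [hij, hij.symm]
  simp only [lieDeriv, LinearMap.sum_apply, LinearMap.smulRight_apply]
  exact Commute.sum_left _ _ _ fun i _ => Commute.sum_right _ _ _ fun j _ =>
    ((h i j).smul_left _).smul_right _

open scoped IsMulCommutative in
/-- The action of `S(V)` on scalar functions by iterated Lie derivatives,
`u₁ ⋯ u_r ↦ L_{u₁} ⋯ L_{u_r}`. -/
def symAction (b : Module.Basis (Fin n) K V) :
    SymmetricAlgebra K V →ₐ[K] Module.End K (Ser n K) :=
  haveI : IsMulCommutative (Algebra.adjoin K (Set.range (lieDeriv (M := K) b))) :=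
    Algebra.isMulCommutative_adjoin K (by
      rintro _ ⟨u, rfl⟩ _ ⟨v, rfl⟩; exact lieDeriv_commute b u v)
  (Algebra.adjoin K (Set.range (lieDeriv (M := K) b))).val.comp
    (SymmetricAlgebra.lift
      ((lieDeriv (M := K) b).codRestrict
        (Subalgebra.toSubmodule (Algebra.adjoin K (Set.range (lieDeriv (M := K) b))))
        (fun v => Algebra.subset_adjoin ⟨v, rfl⟩)))

theorem symAction_ι (b : Module.Basis (Fin n) K V) (v : V) :
    symAction b (SymmetricAlgebra.ι K V v) = lieDeriv b v := by
  simp only [symAction, AlgHom.comp_apply, SymmetricAlgebra.lift_ι_apply]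
  rfl

/-- Polynomial `2`-currents `Γ₂(V) = S(V) ⊗ Λ²V`. -/
abbrev Currents (K V : Type*) [Field K] [AddCommGroup V] [Module K V] : Type _ :=
  SymmetricAlgebra K V ⊗[K] (⋀[K]^2 V)

/-- The double contraction `v₁ ∧ v₂ ↦ ι_{v₁} ι_{v₂} ξ = ξ(v₂, v₁)`. -/
def contract (ξ : Form K V n 2 K) : ⋀[K]^2 V →ₗ[K] Ser n K where
  toFun w := fun α => -(exteriorPower.alternatingMapLinearEquiv (ξ α) w)
  map_add' x y := by
    funext α
    change _ = -(exteriorPower.alternatingMapLinearEquiv (ξ α) x) +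
      -(exteriorPower.alternatingMapLinearEquiv (ξ α) y)
    rw [map_add, neg_add]
  map_smul' c x := by
    funext α
    change _ = c • -(exteriorPower.alternatingMapLinearEquiv (ξ α) x)
    rw [map_smul, smul_neg]

/-- The pairing `⟨u₁ ⋯ u_r ⊗ v₁ ∧ v₂, ξ⟩`, the value at the origin of
`L_{u₁} ⋯ L_{u_r} ι_{v₁} ι_{v₂} ξ`. -/
def pairing (b : Module.Basis (Fin n) K V) (ξ : Form K V n 2 K) : Currents K V →ₗ[K] K :=
  LinearMap.proj (R := K) (φ := fun _ : Fin n →₀ ℕ => K) 0 ∘ₗ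
    TensorProduct.lift ((symAction b).toLinearMap.compl₂ (contract ξ))

/-- Polynomial forms: only finitely many coefficients are nonzero. -/
def IsPolynomial {m : ℕ} (ω : Form K V n m K) : Prop := {α | ω α ≠ 0}.Finite

open Classical in
/-- The pairing of closed `2`-currents with closed polynomial `3`-forms,
`⟨a, ω⟩_cl = -⟨a, ξ⟩` for a polynomial `2`-form `ξ` with `dξ = ω`. (For a closed current `a` this
does not depend on the choice of `ξ`.) -/
def closedPairing (b : Module.Basis (Fin n) K V) (ω : Form K V n 3 K) : Currents K V →ₗ[K] K :=
  if h : ∃ ξ : Form K V n 2 K, IsPolynomial ξ ∧ d b ξ = ω then -pairing b h.choose else 0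

theorem algHom_deltaFree (X : FreeRep K V) :
    SymmetricAlgebra.algHom K V (deltaFree K V X) = 0 := by
  let p : Submodule K (TensorAlgebra K V) :=
    LinearMap.ker (SymmetricAlgebra.algHom K V).toLinearMap
  have h : ∀ x y : TensorAlgebra K V, commutator x y ∈ p := by
    intro x y
    change SymmetricAlgebra.algHom K V (commutator x y) = 0
    rw [commutator_apply, map_sub, map_mul, map_mul, mul_comm, sub_self]
  exact deltaFree_mem p (fun _ _ => h _ _) (fun _ _ _ => h _ _) X

theorem symmetrize_smul (a : TensorAlgebra K V) (X : FreeRep K V) :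
    (SymmetricAlgebra.algHom K V).toLinearMap.rTensor (⋀[K]^2 V) (a • X) =
      SymmetricAlgebra.algHom K V a •
        (SymmetricAlgebra.algHom K V).toLinearMap.rTensor (⋀[K]^2 V) X := by
  induction X using TensorProduct.induction_on with
  | zero => simp
  | tmul c w => simp [TensorProduct.smul_tmul']
  | add x y hx hy => rw [smul_add, map_add, hx, hy, map_add, smul_add]

/-- `ρ : 𝔨₁(V) → Γ₂(V)`, induced by the symmetrization map `T(V) ⊗ Λ²V → S(V) ⊗ Λ²V`. -/
def rho : K1 K V →ₗ[K] Currents K V :=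
  descend K V ((SymmetricAlgebra.algHom K V).toLinearMap.rTensor (⋀[K]^2 V)) (fun X Y => by
    rw [map_add, symmetrize_smul, symmetrize_smul, algHom_deltaFree, algHom_deltaFree,
      zero_smul, zero_smul, add_zero])

/-- `ρ̂(X)` as a map on closed polynomial `3`-forms: a `3`-form `X` with values in `𝔞₁` sends `ω` to
the form obtained by applying the functional `⟨ρ(·), ω⟩_cl` to the values of `X`. -/
def rhoHat (b : Module.Basis (Fin n) K V) (X : Form K V n 3 (K1 K V)) (ω : Form K V n 3 K) :
    Form K V n 3 K :=
  mapForm (closedPairing b ω ∘ₗ rho) X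

end Currents

/-! ### The explicit bases -/

section Bases

/-- The index set of all `(q, i, j, k)` with `q₁ ≥ … ≥ q_r ≥ i < j < k`, `r ≥ 0`. -/
def Index (n : ℕ) : Type :=
  {p : List (Fin n) × Fin n × Fin n × Fin n //
    (p.1 ++ [p.2.1]).Pairwise (· ≥ ·) ∧ p.2.1 < p.2.2.1 ∧ p.2.2.1 < p.2.2.2}

/-- `B_{ijk} = [eᵢ, eⱼ ∧ e_k] - [eⱼ, eᵢ ∧ e_k] + [e_k, eᵢ ∧ eⱼ]`. -/
def B (b : Module.Basis (Fin n) K V) (i j k : Fin n) : K1 K V :=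
  TensorAlgebra.ι K (b i) • gen ![b j, b k] - TensorAlgebra.ι K (b j) • gen ![b i, b k] +
    TensorAlgebra.ι K (b k) • gen ![b i, b j]

/-- `B_{q,ijk} = [e_{q₁}, … [e_{q_r}, B_{ijk}] … ]`. -/
def Bq (b : Module.Basis (Fin n) K V) (q : List (Fin n)) (i j k : Fin n) : K1 K V :=
  q.foldr (fun s X => TensorAlgebra.ι K (b s) • X) (B b i j k)

/-- `ω_{q,ijk} = (z^α / α!) dzⱼ ∧ dz_k`, where `α_s` is the number of times `s` occurs in
`(q, i)`. -/
def omegaq (b : Module.Basis (Fin n) K V) (q : List (Fin n)) (i j k : Fin n) : Form K V n 2 K :=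
  let α : Fin n →₀ ℕ := Finsupp.equivFunOnFinite.symm fun s => (q ++ [i]).count s
  mono α ((((∏ s, (α s).factorial : ℕ) : K)⁻¹) • constWedge (dz b j) (dz b k))

/-- The term `B_{q,ijk} ⊗ d(ω_{q,ijk})`. -/
def term (b : Module.Basis (Fin n) K V) (p : Index n) : Form K V n 3 (K1 K V) :=
  tensorForm (Bq b p.1.1 p.1.2.1 p.1.2.2.1 p.1.2.2.2)
    (d b (omegaq b p.1.1 p.1.2.1 p.1.2.2.1 p.1.2.2.2))

end Bases

end Forms

end UniversalTwoConnection

end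

/-! The main tool is the Euler operator `E`, which multiplies the degree `r` part of a series by
`r`. Because `η` is homogeneous of degree 1, series of exponential type satisfy first order
equations in `E`; in particular `Eθ = ηθ`. In characteristic 0 an equation `Ey + cy = ηy` has only
the zero solution if `c > 0`, and is determined by the constant term if `c = 0`
(`eq_zero_of_euler`). Closed forms are thus proved by comparing Euler equations, and multiplying on
the right by `θ` turns commutators with `η` into left multiplication by `η`.

Abelianization. Since `(k+1)/(k+2)! = 1/(k+1)! - 1/(k+2)!`, `Θ` is a difference of two
exponential-type series, and the Euler method gives `δ(Θ)θ = dθ - θζ₀`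
(`deltaSer_bigTheta_mul_theta`). So `δΘ` cancels the connection form left by `θ`, and `γ₀^ab = 0`.
Differentiating this identity once more gives `δ(ζ₁^ab) = 0`.

Curvature. As `γ₀^ab = 0`, the curvature is `dζ₁^ab`. The Peiffer identity makes the image of `δ`
act by zero on `𝔞₁`, hence on `ζ₁^ab`. With this and the Jacobi identity, every term containing `Θ`
cancels, leaving `𝒦^ab = θ ▷ (ζ₀ ∧ ζ₁)` (`ev_Kab`).

Pairing. The image of the coefficient `θ_α` in `S(V)` is `e^α/α!`, so pairing with it extracts a
Taylor coefficient, while `ρ(ζ₀ ∧ ζ₁)` paired with `ξ` gives `-dξ`. Hence `𝒦^ab` reproduces `dξ`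
(`mapForm_pairing_Kab`). The polynomial Poincaré lemma supplies a primitive for every closed `ω`.

Explicit formula. `T(V)` acts on `𝔞₁` through commuting operators, so `α! θ_α` acts as the monomial
`e^α`. When `e^α ▷ B_{xyz}` contains a factor `eᵢ` with `i < x`, the relation `ζ₀ ∧ ζ₀ ∧ ζ₁ = 0`
rewrites it through elements whose innermost index is minimal. These are the three contributions of
the sum of `B ⊗ dω` on `(e_x, e_y, e_z)`. -/

noncomputable section

namespace UniversalTwoConnection

/-! ### Calculus of vector-valued formal power series -/

section SeriesCalculus

variable {K : Type*} [Field K] {n : ℕ}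
variable {A : Type*} [Ring A] {M N : Type*} [AddCommGroup M] [Module A M] [AddCommGroup N]

open Finset.HasAntidiagonal (antidiagonal mem_antidiagonal)

theorem zero_ser_apply (α : Fin n →₀ ℕ) : (0 : Ser n N) α = 0 := rfl

theorem add_ser_apply (f g : Ser n N) (α : Fin n →₀ ℕ) : (f + g) α = f α + g α := rfl

theorem sub_ser_apply (f g : Ser n N) (α : Fin n →₀ ℕ) : (f - g) α = f α - g α := rfl

theorem neg_ser_apply (f : Ser n N) (α : Fin n →₀ ℕ) : (-f) α = -f α := rfl

theorem smul_ser_apply {R : Type*} [Semiring R] [Module R N] (c : R) (f : Ser n N)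
    (α : Fin n →₀ ℕ) : (c • f) α = c • f α := rfl

theorem nsmul_ser_apply (c : ℕ) (f : Ser n N) (α : Fin n →₀ ℕ) : (c • f) α = c • f α := rfl

theorem sum_ser_apply {ι : Type*} (s : Finset ι) (f : ι → Ser n N) (α : Fin n →₀ ℕ) :
    (∑ i ∈ s, f i) α = ∑ i ∈ s, f i α :=
  Finset.sum_apply _ _ _

theorem act_apply (f : Ser n A) (g : Ser n M) (α : Fin n →₀ ℕ) :
    act f g α = ∑ p ∈ antidiagonal α, f p.1 • g p.2 := rfl

theorem act_eq_mul (f g : Ser n A) : act f g = f * g := by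
  funext α
  exact (MvPowerSeries.coeff_mul α f g).symm

theorem act_add (f : Ser n A) (g h : Ser n M) : act f (g + h) = act f g + act f h := by
  funext α
  refine Eq.trans ?_ Finset.sum_add_distrib
  exact Finset.sum_congr rfl fun p _ => smul_add _ _ _

theorem add_act (f g : Ser n A) (h : Ser n M) : act (f + g) h = act f h + act g h := by
  funext α
  refine Eq.trans ?_ Finset.sum_add_distrib
  exact Finset.sum_congr rfl fun p _ => add_smul _ _ _

/-- The product `act` as a ring homomorphism. -/
def actHom : Ser n A →+* AddMonoid.End (Ser n M) where
  toFun f := AddMonoidHom.mk' (act f) (act_add f)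
  map_one' := by
    refine AddMonoidHom.ext fun g => funext fun α => ?_
    change act 1 g α = g α
    rw [act_apply, Finset.sum_eq_single (0, α)]
    · exact (congrArg (· • g α) (MvPowerSeries.coeff_zero_one (σ := Fin n) (R := A))).trans
        (one_smul _ _)
    · rintro ⟨p, q⟩ hp hne
      have hp0 : p ≠ 0 := by
        rintro rfl
        exact hne (by simpa using hp)
      have h1 : (1 : Ser n A) p = 0 := by
        classical
        exact (MvPowerSeries.coeff_one (σ := Fin n) (R := A) (n := p)).trans (if_neg hp0)
      exact (congrArg (· • g q) h1).trans (zero_smul _ _)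
    · intro h
      exact absurd (by simp) h
  map_mul' f g := by
    refine AddMonoidHom.ext fun h => funext fun α => ?_
    change ∑ p ∈ antidiagonal α, (f * g : Ser n A) p.1 • h p.2 =
      ∑ p ∈ antidiagonal α, f p.1 • ∑ q ∈ antidiagonal p.2, g q.1 • h q.2
    have hmul : ∀ β, (f * g : Ser n A) β = ∑ q ∈ antidiagonal β, f q.1 * g q.2 :=
      fun β => MvPowerSeries.coeff_mul β f g
    simp only [hmul, Finset.sum_smul, Finset.smul_sum, Finset.sum_sigma']
    apply Finset.sum_nbij' (fun ⟨⟨_i, j⟩, ⟨k, l⟩⟩ ↦ ⟨(k, l + j), (l, j)⟩)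
      (fun ⟨⟨i, _j⟩, ⟨k, l⟩⟩ ↦ ⟨(i + k, l), (i, k)⟩)
    all_goals
      rintro ⟨⟨i, j⟩, ⟨k, l⟩⟩ hp
      simp only [Finset.mem_sigma, mem_antidiagonal] at hp ⊢
      obtain ⟨rfl, rfl⟩ := hp
    · simp [add_assoc]
    · simp [add_assoc]
    · rfl
    · rfl
    · exact mul_smul _ _ _
  map_zero' := by
    refine AddMonoidHom.ext fun h => funext fun α => ?_
    exact Finset.sum_eq_zero fun p _ => zero_smul _ _
  map_add' f g := AddMonoidHom.ext fun h => add_act f g h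

theorem act_act (f g : Ser n A) (h : Ser n M) : act f (act g h) = act (f * g) h :=
  (DFunLike.congr_fun (map_mul (actHom (M := M)) f g) h).symm

theorem act_sub (f : Ser n A) (g h : Ser n M) : act f (g - h) = act f g - act f h :=
  map_sub (actHom f) g h

theorem act_zero (f : Ser n A) : act f (0 : Ser n M) = 0 :=
  map_zero (actHom f)

theorem act_sum {ι : Type*} (s : Finset ι) (f : Ser n A) (g : ι → Ser n M) :
    act f (∑ i ∈ s, g i) = ∑ i ∈ s, act f (g i) :=
  map_sum (actHom f) g s

theorem zero_act (h : Ser n M) : act (0 : Ser n A) h = 0 :=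
  DFunLike.congr_fun (map_zero (actHom (n := n) (A := A) (M := M))) h

theorem sub_act (f g : Ser n A) (h : Ser n M) : act (f - g) h = act f h - act g h :=
  DFunLike.congr_fun (map_sub (actHom (M := M)) f g) h

theorem neg_act (f : Ser n A) (h : Ser n M) : act (-f) h = -act f h :=
  DFunLike.congr_fun (map_neg (actHom (M := M)) f) h

theorem act_smul [Algebra K A] [Module K M] [IsScalarTower K A M] (c : K) (f : Ser n A)
    (g : Ser n M) : act f (c • g) = c • act f g := by
  funext α
  rw [smul_ser_apply, act_apply, act_apply, Finset.smul_sum]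
  exact Finset.sum_congr rfl fun p _ => smul_algebra_smul_comm c (f p.1) (g p.2)

theorem mono_act_apply (i : Fin n) (a : A) (g : Ser n M) (α : Fin n →₀ ℕ) :
    act (mono (Finsupp.single i 1) a) g α =
      if 0 < α i then a • g (α - Finsupp.single i 1) else 0 := by
  rw [act_apply]
  split_ifs with h
  · have hle : Finsupp.single i 1 ≤ α := by simpa using Nat.succ_le_of_lt h
    rw [Finset.sum_eq_single (Finsupp.single i 1, α - Finsupp.single i 1)]
    · simp [mono]
    · rintro ⟨p, q⟩ hp hne
      have : p ≠ Finsupp.single i 1 := by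
        rintro rfl
        refine hne ?_
        rw [mem_antidiagonal] at hp
        simp [← hp]
      simp [mono, this]
    · intro hn
      refine absurd ?_ hn
      rw [mem_antidiagonal]
      exact add_tsub_cancel_of_le hle
  · refine Finset.sum_eq_zero ?_
    rintro ⟨p, q⟩ hp
    have : p ≠ Finsupp.single i 1 := by
      rintro rfl
      rw [mem_antidiagonal] at hp
      refine h ?_
      simp [← hp]
    simp [mono, this]

theorem mono_zero_act_apply (a : A) (g : Ser n M) (α : Fin n →₀ ℕ) :
    act (mono 0 a) g α = a • g α := by
  rw [act_apply, Finset.sum_eq_single (0, α)]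
  · simp [mono]
  · rintro ⟨p, q⟩ hp hne
    have : p ≠ 0 := by
      rintro rfl
      exact hne (by simpa using hp)
    simp [mono, this]
  · intro h
    exact absurd (by simp) h

theorem act_mono_zero_apply (f : Ser n A) (x : M) (α : Fin n →₀ ℕ) :
    act f (mono 0 x) α = f α • x := by
  rw [act_apply, Finset.sum_eq_single (α, 0)]
  · simp [mono]
  · rintro ⟨p, q⟩ hp hne
    have : q ≠ 0 := by
      rintro rfl
      exact hne (by simpa using hp)
    simp [mono, this]
  · intro h
    exact absurd (by simp) h

/-- The Euler operator, which multiplies the part of degree `r` by `r`. -/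
def euler : Ser n N →+ Ser n N where
  toFun f := fun α => α.degree • f α
  map_zero' := by funext α; exact smul_zero _
  map_add' f g := by funext α; exact smul_add _ _ _

theorem euler_apply (f : Ser n N) (α : Fin n →₀ ℕ) : euler f α = α.degree • f α := rfl

theorem euler_mono_zero (x : N) : euler (mono (n := n) 0 x) = 0 := by
  funext α
  rw [euler_apply, zero_ser_apply]
  by_cases h : α = 0
  · simp [h]
  · simp [mono, h]

theorem euler_act (f : Ser n A) (g : Ser n M) :
    euler (act f g) = act (euler f) g + act f (euler g) := by
  funext α
  refine Eq.trans ?_ Finset.sum_add_distrib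
  rw [euler_apply, act_apply, Finset.smul_sum]
  refine Finset.sum_congr rfl fun p hp => ?_
  rw [mem_antidiagonal] at hp
  rw [euler_apply, euler_apply, ← hp, map_add, add_smul, smul_assoc, smul_comm (f p.1)]

theorem euler_mul (f g : Ser n A) : euler (f * g) = euler f * g + f * euler g := by
  simpa only [act_eq_mul] using euler_act f g

/-- A solution of `E y + c y = η y` is determined by its constant term, and it vanishes if
`c ≠ 0`. -/
theorem eq_zero_of_euler [Algebra K A] [CharZero K] [Module K M] {η : Ser n A} (hη : η 0 = 0)
    (c : ℕ) {y : Ser n M} (hy : euler y + c • y = act η y) (h0 : c = 0 → y 0 = 0) : y = 0 := by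
  suffices h : ∀ r, ∀ α : Fin n →₀ ℕ, α.degree = r → y α = 0 from funext fun α => h _ α rfl
  intro r
  induction r using Nat.strong_induction_on with
  | _ r ih =>
    intro α hα
    -- The only coefficient whose factor `|α| + c` vanishes; it is supplied by `h0`.
    by_cases hα0 : α = 0 ∧ c = 0
    · rw [hα0.1]; exact h0 hα0.2
    have h1 : (α.degree + c) • y α = act η y α := by
      rw [← hy, add_smul]; rfl
    -- As `η` has no constant term, only coefficients of `y` of degree below `|α|` enter, and these
    -- vanish by induction.
    have h2 : act η y α = 0 := by
      refine Finset.sum_eq_zero fun p hp => ?_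
      rw [mem_antidiagonal] at hp
      by_cases hp1 : p.1 = 0
      · rw [hp1, hη, zero_smul]
      · rw [ih p.2.degree _ p.2 rfl, smul_zero]
        have hpos : p.1.degree ≠ 0 := by rwa [Ne, Finsupp.degree_eq_zero_iff]
        rw [← hα, ← hp, map_add]
        omega
    rw [h2, ← Nat.cast_smul_eq_nsmul K] at h1
    refine (smul_eq_zero.1 h1).resolve_left ?_
    refine Nat.cast_ne_zero.2 fun h => ?_
    refine hα0 ⟨?_, by omega⟩
    have : α.degree = 0 := by omega
    rwa [Finsupp.degree_eq_zero_iff] at this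

variable [Module K N]

theorem pderiv_apply (i : Fin n) (f : Ser n N) (α : Fin n →₀ ℕ) :
    pderiv K i f α = (α i + 1) • f (α + Finsupp.single i 1) := rfl

theorem euler_pderiv (i : Fin n) (f : Ser n N) :
    euler (pderiv K i f) = pderiv K i (euler f) - pderiv K i f := by
  funext α
  simp only [sub_ser_apply, euler_apply, pderiv_apply, map_add, Finsupp.degree_single]
  rw [add_smul α.degree, one_smul, smul_add, add_sub_cancel_right, smul_comm]

theorem sum_antidiagonal_swap (α : Fin n →₀ ℕ) (F : (Fin n →₀ ℕ) × (Fin n →₀ ℕ) → N) :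
    ∑ p ∈ antidiagonal α, F p = ∑ p ∈ antidiagonal α, F (p.2, p.1) :=
  Finset.sum_nbij' Prod.swap Prod.swap (by simp [add_comm]) (by simp [add_comm]) (by simp)
    (by simp) (by simp)

/-- The reindexing behind the Leibniz rule: the pairs missed by the shift have `p.1 i = 0`, so their
weight kills them. -/
theorem sum_antidiagonal_add_single (i : Fin n) (α : Fin n →₀ ℕ)
    (F : (Fin n →₀ ℕ) → (Fin n →₀ ℕ) → N) :
    ∑ p ∈ antidiagonal (α + (Finsupp.single i 1 : Fin n →₀ ℕ)), p.1 i • F p.1 p.2 =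
      ∑ p ∈ antidiagonal α, (p.1 i + 1) • F (p.1 + Finsupp.single i 1) p.2 := by
  symm
  refine Finset.sum_of_injOn (fun p => (p.1 + Finsupp.single i 1, p.2)) ?_ ?_ ?_ ?_
  · rintro ⟨p, q⟩ _ ⟨p', q'⟩ _ h
    simpa using h
  · rintro ⟨p, q⟩ hp
    simp only [Finset.mem_coe, mem_antidiagonal] at hp ⊢
    rw [← hp, add_right_comm]
  · rintro ⟨p, q⟩ hp hn
    rw [mem_antidiagonal] at hp
    have : p i = 0 := by
      by_contra hpi
      refine hn ⟨(p - Finsupp.single i 1, q), ?_, ?_⟩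
      · simp only [Finset.mem_coe, mem_antidiagonal] at hp ⊢
        have hle : Finsupp.single i 1 ≤ p := by simpa using Nat.one_le_iff_ne_zero.2 hpi
        refine add_right_cancel (b := Finsupp.single i 1) ?_
        rw [← hp, add_right_comm, tsub_add_cancel_of_le hle]
      · have hle : Finsupp.single i 1 ≤ p := by simpa using Nat.one_le_iff_ne_zero.2 hpi
        simp [tsub_add_cancel_of_le hle]
    simp [this]
  · rintro ⟨p, q⟩ hp
    simp

/-- On the antidiagonal of `α + eᵢ` the factor `αᵢ + 1` splits as `p.1 i + p.2 i`; the two parts are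
the two Leibniz terms. -/
theorem pderiv_act [Algebra K A] [Module K M] (i : Fin n) (f : Ser n A) (g : Ser n M) :
    pderiv K i (act f g) = act (pderiv K i f) g + act f (pderiv K i g) := by
  funext α
  have h1 : act (pderiv K i f) g α =
      ∑ p ∈ antidiagonal (α + (Finsupp.single i 1 : Fin n →₀ ℕ)), p.1 i • (f p.1 • g p.2) := by
    rw [sum_antidiagonal_add_single i α fun x y => f x • g y]
    exact Finset.sum_congr rfl fun p _ => smul_assoc _ _ _
  have h2 : act f (pderiv K i g) α =
      ∑ p ∈ antidiagonal (α + (Finsupp.single i 1 : Fin n →₀ ℕ)), p.2 i • (f p.1 • g p.2) := by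
    rw [sum_antidiagonal_swap]
    refine Eq.trans ?_ (sum_antidiagonal_add_single i α fun x y => f y • g x).symm
    rw [act_apply, sum_antidiagonal_swap]
    exact Finset.sum_congr rfl fun p _ => smul_comm _ _ _
  change pderiv K i (act f g) α = act (pderiv K i f) g α + act f (pderiv K i g) α
  rw [h1, h2, ← Finset.sum_add_distrib, pderiv_apply, act_apply, Finset.smul_sum]
  refine Finset.sum_congr rfl fun p hp => ?_
  rw [mem_antidiagonal] at hp
  rw [← add_smul]
  congr 1
  have := DFunLike.congr_fun hp i
  simpa using this.symm

end SeriesCalculus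

/-! ### Lie derivatives along constant vector fields -/

section LieDerivative

variable {K V : Type*} [Field K] [AddCommGroup V] [Module K V] {n : ℕ}
variable {A : Type*} [Ring A] {M : Type*} [AddCommGroup M] [Module A M] [Module K M]
variable (b : Module.Basis (Fin n) K V)

theorem lieDeriv_eq_sum (v : V) (f : Ser n M) :
    lieDeriv b v f = ∑ i, b.coord i v • pderiv K i f := by
  simp [lieDeriv, LinearMap.sum_apply]

theorem lieDeriv_basis (i : Fin n) (f : Ser n M) : lieDeriv b (b i) f = pderiv K i f := by
  rw [lieDeriv_eq_sum, Finset.sum_eq_single i]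
  · simp
  · intro j _ hj
    simp [hj.symm]
  · simp

theorem lieDeriv_comm (u v : V) (f : Ser n M) :
    lieDeriv b u (lieDeriv b v f) = lieDeriv b v (lieDeriv b u f) :=
  LinearMap.congr_fun (lieDeriv_commute b u v).eq f

theorem lieDeriv_act [Algebra K A] [IsScalarTower K A M] (v : V) (f : Ser n A) (g : Ser n M) :
    lieDeriv b v (act f g) = act (lieDeriv b v f) g + act f (lieDeriv b v g) := by
  have hl : ∀ (c : K) (f : Ser n A), act (c • f) g = c • act f g := by
    intro c f
    funext α
    rw [smul_ser_apply, act_apply, act_apply, Finset.smul_sum]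
    exact Finset.sum_congr rfl fun p _ => smul_assoc c (f p.1) (g p.2)
  have hs : ∀ F : Fin n → Ser n A, act (∑ i, F i) g = ∑ i, act (F i) g := fun F =>
    (DFunLike.congr_fun (map_sum (actHom (M := M)) F Finset.univ) g).trans
      (AddMonoidHom.finsetSum_apply _ _ _)
  simp only [lieDeriv_eq_sum, pderiv_act, hs, hl, act_sum, act_smul, smul_add,
    Finset.sum_add_distrib]

theorem lieDeriv_mul [Algebra K A] (v : V) (f g : Ser n A) :
    lieDeriv b v (f * g) = lieDeriv b v f * g + f * lieDeriv b v g := by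
  simpa only [act_eq_mul] using lieDeriv_act b v f g

theorem euler_lieDeriv (v : V) (f : Ser n M) :
    euler (lieDeriv b v f) = lieDeriv b v (euler f) - lieDeriv b v f := by
  have hs : ∀ (c : K) (f : Ser n M), euler (c • f) = c • euler f := fun c f => by
    funext α
    exact smul_comm _ _ _
  simp only [lieDeriv_eq_sum, map_sum, hs, euler_pderiv, smul_sub, Finset.sum_sub_distrib]

theorem lieDeriv_mono_zero (v : V) (x : M) : lieDeriv b v (mono 0 x) = 0 := by
  rw [lieDeriv_eq_sum]
  refine Finset.sum_eq_zero fun i _ => ?_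
  have : pderiv K i (mono 0 x) = 0 := by
    funext α
    rw [pderiv_apply]
    have h : α + Finsupp.single i 1 ≠ 0 := by
      intro h
      simpa using DFunLike.congr_fun h i
    simp [mono, h, zero_ser_apply]
  rw [this, smul_zero]

end LieDerivative

/-! ### Exponential-type series and their Euler equations -/

section ExponentialSeries

variable {K : Type*} [Field K] {n : ℕ}
variable {A : Type*} [Ring A] {M : Type*} [AddCommGroup M] [Module A M] [Module K M]

open Finset.HasAntidiagonal (antidiagonal mem_antidiagonal)

/-- The series `f` is homogeneous of degree `r`. -/
def IsHomogeneousOf {N : Type*} [AddCommGroup N] (r : ℕ) (f : Ser n N) : Prop :=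
  ∀ α : Fin n →₀ ℕ, α.degree ≠ r → f α = 0

theorem IsHomogeneousOf.act {η : Ser n A} {x : Ser n M} {r s : ℕ} (hη : IsHomogeneousOf r η)
    (hx : IsHomogeneousOf s x) : IsHomogeneousOf (r + s) (act η x) := by
  intro α hα
  refine Finset.sum_eq_zero fun p hp => ?_
  rw [mem_antidiagonal] at hp
  by_cases h1 : p.1.degree = r
  · rw [hx p.2, smul_zero]
    intro h2
    exact hα (by rw [← hp, map_add, h1, h2])
  · rw [hη p.1 h1, zero_smul]

theorem IsHomogeneousOf.iterate_act {η : Ser n A} {x : Ser n M} {r : ℕ}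
    (hη : IsHomogeneousOf 1 η) (hx : IsHomogeneousOf r x) (k : ℕ) :
    IsHomogeneousOf (k + r) ((UniversalTwoConnection.act η)^[k] x) := by
  induction k with
  | zero => simpa using hx
  | succ k ih =>
    rw [Function.iterate_succ_apply', show k + 1 + r = 1 + (k + r) by omega]
    exact hη.act ih

/-- The series `∑ₖ cₖ ηᵏ x`, for a series `η` that is homogeneous of degree `1`. -/
def expSum (c : ℕ → K) (η : Ser n A) (x : Ser n M) : Ser n M := fun α =>
  ∑ k ∈ Finset.range (α.degree + 1), c k • ((act η)^[k] x) α

/-- The `k`-th term has degree `k + r ≥ k`, so raising the truncation bound adds only zeros. This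
gives all coefficients entering one identity a common summation range. -/
theorem expSum_apply_eq (c : ℕ → K) {η : Ser n A} {x : Ser n M} {r : ℕ}
    (hη : IsHomogeneousOf 1 η) (hx : IsHomogeneousOf r x) (α : Fin n →₀ ℕ) {m : ℕ}
    (hm : α.degree ≤ m) :
    expSum c η x α = ∑ k ∈ Finset.range (m + 1), c k • ((act η)^[k] x) α := by
  refine Finset.sum_subset (by simpa using hm) fun k _ hk => ?_
  rw [hη.iterate_act hx k α, smul_zero]
  simp only [Finset.mem_range] at hk
  omega

/-- The Euler equation of an exponential-type series. -/
theorem euler_expSum [Algebra K A] [IsScalarTower K A M] (c : ℕ → K) {η : Ser n A}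
    {x : Ser n M} {r : ℕ} (hη : IsHomogeneousOf 1 η) (hx : IsHomogeneousOf r x) (s : ℕ)
    (hc : ∀ k : ℕ, ((k + 1 + r + s : ℕ) : K) * c (k + 1) = c k) :
    euler (expSum c η x) + s • expSum c η x =
      (((r + s : ℕ) : K) * c 0) • x + act η (expSum c η x) := by
  funext α
  -- The range has one extra term, so that removing `k = 0` and shifting by one matches the range on
  -- the right. A term is nonzero only for `|α| = k + r`, so `|α|` may be replaced by `k + r`.
  have hL : (euler (expSum c η x) + s • expSum c η x) α =
      ∑ k ∈ Finset.range (α.degree + 2), (((k + r + s : ℕ) : K) * c k) • ((act η)^[k] x) α := by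
    rw [add_ser_apply, euler_apply, nsmul_ser_apply, ← add_smul,
      expSum_apply_eq c hη hx α (Nat.le_succ _), Finset.smul_sum]
    refine Finset.sum_congr rfl fun k _ => ?_
    by_cases h : α.degree = k + r
    · rw [h, mul_smul, Nat.cast_smul_eq_nsmul]
    · rw [hη.iterate_act hx k α h, smul_zero, smul_zero, smul_zero]
  have hR : act η (expSum c η x) α =
      ∑ k ∈ Finset.range (α.degree + 1), c k • ((act η)^[k + 1] x) α := by
    have h1 : ∀ p ∈ antidiagonal α, η p.1 • expSum c η x p.2 =
        ∑ k ∈ Finset.range (α.degree + 1), c k • (η p.1 • ((act η)^[k] x) p.2) := by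
      intro p hp
      rw [mem_antidiagonal] at hp
      rw [expSum_apply_eq c hη hx p.2 (m := α.degree) (by rw [← hp, map_add]; omega),
        Finset.smul_sum]
      exact Finset.sum_congr rfl fun k _ => smul_algebra_smul_comm _ _ _
    rw [act_apply, Finset.sum_congr rfl h1, Finset.sum_comm]
    refine Finset.sum_congr rfl fun k _ => ?_
    rw [Function.iterate_succ_apply', act_apply, Finset.smul_sum]
  rw [hL, add_ser_apply, hR, smul_ser_apply, Finset.sum_range_succ', add_comm]
  congr 1
  · simp
  · refine Finset.sum_congr rfl fun k _ => ?_
    rw [hc]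

end ExponentialSeries

/-! ### The series `η` and `θ` -/

section EtaTheta

variable {K V : Type*} [Field K] [AddCommGroup V] [Module K V] {n : ℕ}
variable (b : Module.Basis (Fin n) K V)

theorem homogeneous_mono {N : Type*} [AddCommGroup N] (α : Fin n →₀ ℕ) (x : N) :
    IsHomogeneousOf α.degree (mono α x) := by
  intro β hβ
  have : β ≠ α := fun h => hβ (by rw [h])
  simp [mono, this]

theorem IsHomogeneousOf.sum {N ι : Type*} [AddCommGroup N] {r : ℕ} (s : Finset ι)
    (f : ι → Ser n N) (hf : ∀ i ∈ s, IsHomogeneousOf r (f i)) :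
    IsHomogeneousOf r (∑ i ∈ s, f i) := fun α hα => by
  rw [sum_ser_apply]
  exact Finset.sum_eq_zero fun i hi => hf i hi α hα

theorem homogeneous_eta : IsHomogeneousOf 1 (eta b) :=
  IsHomogeneousOf.sum _ _ fun i _ => by
    have := homogeneous_mono (Finsupp.single i 1) (TensorAlgebra.ι K (b i))
    rwa [Finsupp.degree_single] at this

theorem eta_zero : eta b 0 = 0 := homogeneous_eta b 0 (by simp)

theorem act_eta_apply {M : Type*} [AddCommGroup M] [Module (TensorAlgebra K V) M]
    (g : Ser n M) (α : Fin n →₀ ℕ) :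
    act (eta b) g α =
      ∑ i, if 0 < α i then TensorAlgebra.ι K (b i) • g (α - Finsupp.single i 1) else 0 := by
  have : act (eta b) g = ∑ i, act (mono (Finsupp.single i 1) (TensorAlgebra.ι K (b i))) g :=
    (DFunLike.congr_fun (map_sum (actHom (M := M)) _ Finset.univ) g).trans
      (AddMonoidHom.finsetSum_apply _ _ _)
  rw [this, sum_ser_apply]
  exact Finset.sum_congr rfl fun i _ => mono_act_apply _ _ _ _

theorem lieDeriv_eta (v : V) : lieDeriv b v (eta b) = mono 0 (TensorAlgebra.ι K v) := by
  have h : ∀ i j : Fin n, pderiv K i (mono (Finsupp.single j 1) (TensorAlgebra.ι K (b j))) =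
      if i = j then mono 0 (TensorAlgebra.ι K (b j)) else 0 := by
    intro i j
    funext α
    rw [pderiv_apply]
    by_cases hij : i = j
    · subst hij
      rw [if_pos rfl]
      by_cases hα : α = 0
      · simp [hα, mono]
      · simp [hα, mono]
    · rw [if_neg hij, zero_ser_apply]
      have : α + Finsupp.single i 1 ≠ Finsupp.single j 1 := by
        intro h
        have := DFunLike.congr_fun h i
        simp [Ne.symm hij] at this
      simp [mono, this]
  rw [lieDeriv_eq_sum]
  have h2 : ∀ i, pderiv K i (eta b) = mono 0 (TensorAlgebra.ι K (b i)) := by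
    intro i
    rw [eta, map_sum]
    simp only [h]
    simp
  simp only [h2]
  funext α
  rw [sum_ser_apply]
  by_cases hα : α = 0
  · simp only [smul_ser_apply, mono, hα, if_true]
    conv_rhs => rw [← b.sum_repr v, map_sum]
    simp
  · simp [smul_ser_apply, mono, hα]

theorem theta_eq_expSum :
    theta b = expSum (fun k => ((k.factorial : K)⁻¹)) (eta b) (1 : Ser n (TensorAlgebra K V)) := by
  have h : ∀ k : ℕ, eta b ^ k = (act (eta b))^[k] (1 : Ser n (TensorAlgebra K V)) := by
    intro k
    induction k with
    | zero => rfl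
    | succ k ih => rw [Function.iterate_succ_apply', ← ih, act_eq_mul, pow_succ']
  funext α
  simp only [theta, expSer, expSum, h]

theorem one_eq_mono {A : Type*} [Ring A] : (1 : Ser n A) = mono 0 1 := by
  classical
  funext α
  refine (MvPowerSeries.coeff_one (σ := Fin n) (R := A) (n := α)).trans ?_
  simp [mono]

theorem theta_zero : theta b 0 = 1 := by
  rw [theta_eq_expSum, one_eq_mono]
  simp [expSum, mono]

/-- The constant term is 1. `Ring.inverse` is 0 on non-units, so this makes the `θ⁻¹` of the gauge
action a genuine inverse. -/
theorem isUnit_theta : IsUnit (theta b) := by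
  have h : MvPowerSeries.constantCoeff (theta b) = ((1 : (TensorAlgebra K V)ˣ) : TensorAlgebra K V) :=
    theta_zero b
  exact ⟨⟨theta b, MvPowerSeries.invOfUnit _ 1, MvPowerSeries.mul_invOfUnit _ 1 h,
    MvPowerSeries.invOfUnit_mul _ 1 h⟩, rfl⟩

variable [CharZero K]

/-- The case `r = s = 0`, `x = 1` of `euler_expSum`, where the inhomogeneous term has coefficient 0.
-/
theorem euler_theta : euler (theta b) = eta b * theta b := by
  have h := euler_expSum (fun k => ((k.factorial : K)⁻¹)) (η := eta b)
    (x := (1 : Ser n (TensorAlgebra K V))) (r := 0) (homogeneous_eta b)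
    (by rw [one_eq_mono]; simpa using homogeneous_mono (0 : Fin n →₀ ℕ) (1 : TensorAlgebra K V))
    0 (fun k => by
      have : ((k + 1 : ℕ) : K) ≠ 0 := Nat.cast_ne_zero.2 (Nat.succ_ne_zero k)
      rw [Nat.factorial_succ, Nat.cast_mul, mul_inv, add_zero, add_zero, mul_inv_cancel_left₀ this])
  rw [← theta_eq_expSum] at h
  simpa [act_eq_mul] using h

end EtaTheta

/-! ### The crossed module identities -/

section CrossedModuleIdentities

variable {K V : Type*} [Field K] [AddCommGroup V] [Module K V]

/-- The boundary map `δ`, with values in `T(V) ⊇ 𝔨₀`. -/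
def deltaT : K1 K V →ₗ[K] TensorAlgebra K V := (K0 K V).subtype ∘ₗ delta K V

theorem deltaT_mk (X : FreeRep K V) : deltaT ((peiffer K V).mkQ X) = deltaFree K V X := rfl

theorem mem_A1_iff (X : K1 K V) : X ∈ A1 K V ↔ deltaT X = 0 := by
  rw [A1, LinearMap.mem_ker, deltaT, LinearMap.comp_apply, Submodule.subtype_apply,
    ZeroMemClass.coe_eq_zero]

theorem deltaT_smul (a : TensorAlgebra K V) (X : K1 K V) :
    deltaT (a • X) = adjointAction K V a (deltaT X) := by
  obtain ⟨X, rfl⟩ := (peiffer K V).mkQ_surjective X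
  rw [← map_smul, deltaT_mk, deltaT_mk, deltaFree_smul]

theorem adjointAction_deltaT (X : K1 K V) :
    adjointAction K V (deltaT X) = commutator (deltaT X) := by
  obtain ⟨X, rfl⟩ := (peiffer K V).mkQ_surjective X
  rw [deltaT_mk, adjointAction_deltaFree]

/-- The Peiffer identity `δ(X) ▷ Y = -δ(Y) ▷ X`. -/
theorem deltaT_smul_eq_neg (X Y : K1 K V) : deltaT X • Y = -(deltaT Y • X) := by
  obtain ⟨X, rfl⟩ := (peiffer K V).mkQ_surjective X
  obtain ⟨Y, rfl⟩ := (peiffer K V).mkQ_surjective Y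
  rw [← add_eq_zero_iff_eq_neg, deltaT_mk, deltaT_mk, ← map_smul, ← map_smul, ← map_add,
    Submodule.mkQ_apply, Submodule.Quotient.mk_eq_zero]
  exact Submodule.subset_span ⟨X, Y, rfl⟩

theorem deltaT_gen (u v : V) :
    deltaT (gen ![u, v] : K1 K V) =
      TensorAlgebra.ι K u * TensorAlgebra.ι K v - TensorAlgebra.ι K v * TensorAlgebra.ι K u := by
  rw [← wedgeToCommutator_apply]
  refine (deltaT_mk _).trans ?_
  rw [TensorProduct.mk_apply, deltaFree_tmul, map_one]
  rfl

theorem smul_mem_A1 (a : TensorAlgebra K V) {X : K1 K V} (hX : X ∈ A1 K V) : a • X ∈ A1 K V := by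
  rw [mem_A1_iff] at *
  rw [deltaT_smul, hX, map_zero]

/-- The left `T(V)`-module `𝔞₁` is commutative. -/
theorem ι_smul_comm {X : K1 K V} (hX : X ∈ A1 K V) (u v : V) :
    TensorAlgebra.ι K u • TensorAlgebra.ι K v • X =
      TensorAlgebra.ι K v • TensorAlgebra.ι K u • X := by
  rw [mem_A1_iff] at hX
  -- The commutator `[u, v]` is `δ(u ∧ v)`, so the Peiffer identity exchanges it with `δ(X) = 0`.
  rw [← sub_eq_zero, ← mul_smul, ← mul_smul, ← sub_smul, ← deltaT_gen, deltaT_smul_eq_neg, hX,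
    zero_smul, neg_zero]

end CrossedModuleIdentities

/-! ### Values of forms on constant vector fields -/

section Evaluation

variable {K V : Type*} [Field K] [AddCommGroup V] [Module K V] {n : ℕ}
variable {M N : Type*} [AddCommGroup M] [Module K M] [AddCommGroup N] [Module K N]
variable {A : Type*} [Ring A] [Algebra K A] [Module A M] [IsScalarTower K A M]

/-- Apply a linear map to the coefficients of a series. -/
def mapSer (φ : M →ₗ[K] N) : Ser n M →ₗ[K] Ser n N where
  toFun f := fun α => φ (f α)
  map_add' f g := by funext α; exact map_add φ _ _
  map_smul' c f := by funext α; exact map_smul φ _ _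

theorem mapSer_apply (φ : M →ₗ[K] N) (f : Ser n M) (α : Fin n →₀ ℕ) :
    mapSer φ f α = φ (f α) := rfl

theorem mapSer_mono (φ : M →ₗ[K] N) (α : Fin n →₀ ℕ) (x : M) :
    mapSer φ (mono α x) = mono α (φ x) := by
  funext β
  rw [mapSer_apply, mono, mono, apply_ite φ, map_zero]

theorem euler_mapSer (φ : M →ₗ[K] N) (f : Ser n M) :
    euler (mapSer φ f) = mapSer φ (euler f) := by
  funext α
  exact (map_nsmul φ _ _).symm

theorem lieDeriv_mapSer (b : Module.Basis (Fin n) K V) (v : V) (φ : M →ₗ[K] N) (f : Ser n M) :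
    lieDeriv b v (mapSer φ f) = mapSer φ (lieDeriv b v f) := by
  simp only [lieDeriv_eq_sum, map_sum, map_smul]
  refine Finset.sum_congr rfl fun i _ => congrArg _ (funext fun α => ?_)
  exact (map_nsmul φ _ _).symm

/-- The value of a constant form, as a linear map. -/
def evalAt {m : ℕ} (v : Fin m → V) : (V [⋀^Fin m]→ₗ[K] M) →ₗ[K] M where
  toFun f := f v
  map_add' _ _ := rfl
  map_smul' _ _ := rfl

theorem alternatingMap_sum_apply {ι : Type*} (s : Finset ι) {m : ℕ}
    (f : ι → V [⋀^Fin m]→ₗ[K] M) (v : Fin m → V) : (∑ i ∈ s, f i) v = ∑ i ∈ s, f i v :=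
  map_sum (evalAt v) f s

/-- The value of a form on constant vector fields. -/
def ev {m : ℕ} (v : Fin m → V) : Form K V n m M →ₗ[K] Ser n M := mapSer (evalAt v)

theorem ev_apply {m : ℕ} (v : Fin m → V) (ω : Form K V n m M) (α : Fin n →₀ ℕ) :
    ev v ω α = ω α v := rfl

theorem ev_tensorForm_apply {m : ℕ} (v : Fin m → V) (x : M) (ω : Form K V n m K)
    (α : Fin n →₀ ℕ) : ev v (tensorForm x ω) α = ev v ω α • x := rfl

theorem ev_mono {m : ℕ} (v : Fin m → V) (α : Fin n →₀ ℕ) (x : V [⋀^Fin m]→ₗ[K] M) :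
    ev v (mono α x) = mono α (x v) :=
  mapSer_mono _ _ _

theorem form_ext {m : ℕ} {ω ψ : Form K V n m M} (h : ∀ v, ev v ω = ev v ψ) : ω = ψ :=
  funext fun α => AlternatingMap.ext fun v => congrFun (h v) α

theorem eq_const {W : Type*} (v : Fin 1 → W) : v = fun _ => v 0 :=
  funext fun i => by rw [Subsingleton.elim i 0]

theorem eq_vec2 {W : Type*} (v : Fin 2 → W) : v = ![v 0, v 1] := by
  ext i; fin_cases i <;> rfl

theorem eq_vec3 {W : Type*} (v : Fin 3 → W) : v = ![v 0, v 1, v 2] := by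
  ext i; fin_cases i <;> rfl

theorem ev_act {m : ℕ} (v : Fin m → V) (f : Ser n A) (ω : Form K V n m M) :
    ev v (act f ω) = act f (ev v ω) := by
  funext α
  rw [ev_apply, act_apply, act_apply, alternatingMap_sum_apply]
  rfl

theorem ev_rightMul {m : ℕ} (v : Fin m → V) (ω : Form K V n m A) (f : Ser n A) :
    ev v (rightMul ω f) = ev v ω * f := by
  funext α
  rw [← act_eq_mul, ev_apply, rightMul, act_apply, alternatingMap_sum_apply]
  rfl

theorem ev_dFun (b : Module.Basis (Fin n) K V) (v : V) (f : Ser n M) :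
    ev (fun _ => v) (dFun b f) = lieDeriv b v f := rfl

theorem ev_d (b : Module.Basis (Fin n) K V) {m : ℕ} (v : Fin (m + 1) → V)
    (ω : Form K V n m M) :
    ev v (d b ω) = ∑ i : Fin (m + 1), (-1) ^ (i : ℕ) • lieDeriv b (v i) (ev (i.removeNth v) ω) := by
  funext α
  rw [ev_apply, d, AlternatingMap.alternatizeUncurryFin_apply, sum_ser_apply]
  refine Finset.sum_congr rfl fun i _ => ?_
  rw [ev, lieDeriv_mapSer]
  rfl

theorem removeNth_pair {W : Type*} (u v : W) :
    (0 : Fin 2).removeNth ![u, v] = (fun _ => v) ∧ (1 : Fin 2).removeNth ![u, v] = fun _ => u := by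
  constructor <;> ext i <;> fin_cases i <;> rfl

theorem removeNth_triple {W : Type*} (u v w : W) :
    (0 : Fin 3).removeNth ![u, v, w] = ![v, w] ∧ (1 : Fin 3).removeNth ![u, v, w] = ![u, w] ∧
      (2 : Fin 3).removeNth ![u, v, w] = ![u, v] := by
  refine ⟨?_, ?_, ?_⟩ <;> ext i <;> fin_cases i <;> rfl

theorem ev_d_one (b : Module.Basis (Fin n) K V) (u v : V) (ω : Form K V n 1 M) :
    ev ![u, v] (d b ω) =
      lieDeriv b u (ev (fun _ => v) ω) - lieDeriv b v (ev (fun _ => u) ω) := by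
  rw [ev_d, Fin.sum_univ_two, (removeNth_pair u v).1, (removeNth_pair u v).2]
  simp [sub_eq_add_neg]

theorem ev_d_two (b : Module.Basis (Fin n) K V) (u v w : V) (ω : Form K V n 2 M) :
    ev ![u, v, w] (d b ω) =
      lieDeriv b u (ev ![v, w] ω) - lieDeriv b v (ev ![u, w] ω) + lieDeriv b w (ev ![u, v] ω) := by
  rw [ev_d, Fin.sum_univ_three, (removeNth_triple u v w).1, (removeNth_triple u v w).2.1,
    (removeNth_triple u v w).2.2]
  simp [sub_eq_add_neg]

theorem constWedge_apply_pair (γ : V [⋀^Fin 1]→ₗ[K] A) (ω : V [⋀^Fin 1]→ₗ[K] M) (u v : V) :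
    constWedge γ ω ![u, v] =
      γ (fun _ => u) • ω (fun _ => v) - γ (fun _ => v) • ω (fun _ => u) := by
  rw [constWedge, AlternatingMap.alternatizeUncurryFin_apply, Fin.sum_univ_two,
    (removeNth_pair u v).1, (removeNth_pair u v).2]
  simp only [Fin.val_zero, Fin.val_one, pow_zero, pow_one, one_smul, neg_smul, sub_eq_add_neg]
  rfl

theorem ev_wedge_one (γ : Form K V n 1 A) (ω : Form K V n 1 M) (u v : V) :
    ev ![u, v] (wedge γ ω) =
      act (ev (fun _ => u) γ) (ev (fun _ => v) ω) -
        act (ev (fun _ => v) γ) (ev (fun _ => u) ω) := by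
  funext α
  rw [ev_apply, wedge, alternatingMap_sum_apply, sub_ser_apply, act_apply, act_apply,
    ← Finset.sum_sub_distrib]
  exact Finset.sum_congr rfl fun p _ => constWedge_apply_pair _ _ _ _

/-- Coefficientwise, the second derivative is symmetric in its two directions because Lie
derivatives commute, and alternation kills it. -/
theorem d_d (b : Module.Basis (Fin n) K V) {m : ℕ} (ω : Form K V n m M) : d b (d b ω) = 0 := by
  funext α
  let φ : V →ₗ[K] V →ₗ[K] V [⋀^Fin m]→ₗ[K] M :=
    LinearMap.mk₂ K (fun u v => lieDeriv b u (lieDeriv b v ω) α)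
      (fun _ _ _ => by rw [map_add]; rfl) (fun _ _ _ => by rw [map_smul]; rfl)
      (fun _ _ _ => by rw [map_add, LinearMap.add_apply, map_add]; rfl)
      (fun _ _ _ => by rw [map_smul, LinearMap.smul_apply, map_smul]; rfl)
  have h := AlternatingMap.alternatizeUncurryFin_alternatizeUncurryFinLM_comp_of_symmetric
    (f := φ) (fun x y => congrFun (lieDeriv_comm b x y ω) α)
  refine Eq.trans ?_ h
  refine congrArg AlternatingMap.alternatizeUncurryFin (LinearMap.ext fun u => ?_)
  refine AlternatingMap.ext fun v => ?_
  change ev v (lieDeriv b u (d b ω)) α = AlternatingMap.alternatizeUncurryFin (φ u) v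
  rw [ev, ← lieDeriv_mapSer]
  change lieDeriv b u (ev v (d b ω)) α = _
  rw [ev_d, AlternatingMap.alternatizeUncurryFin_apply, map_sum, sum_ser_apply]
  refine Finset.sum_congr rfl fun i _ => ?_
  rw [map_zsmul, ev, lieDeriv_mapSer, lieDeriv_mapSer]
  rfl

end Evaluation

/-! ### The abelianizing gauge transformation -/

section Abelianization

variable {K V : Type*} [Field K] [AddCommGroup V] [Module K V] {n : ℕ}

open Finset.HasAntidiagonal (antidiagonal mem_antidiagonal)

/-- `δ` applied to the values of a series. -/
abbrev deltaSer : Ser n (K1 K V) →ₗ[K] Ser n (TensorAlgebra K V) := mapSer deltaT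

/-- The action extending the adjoint one is multiplicative in `f`, whereas the commutator is not;
`hf` asks that they agree on the coefficients of `f`. This holds for values of `δ` and for vectors
of `V`. -/
theorem deltaSer_act {f : Ser n (TensorAlgebra K V)}
    (hf : ∀ α, adjointAction K V (f α) = commutator (f α)) (X : Ser n (K1 K V)) :
    deltaSer (act f X) = f * deltaSer X - deltaSer X * f := by
  funext α
  rw [← act_eq_mul, ← act_eq_mul, sub_ser_apply, act_apply, act_apply,
    sum_antidiagonal_swap α fun p => deltaSer X p.1 • f p.2, ← Finset.sum_sub_distrib,
    mapSer_apply, act_apply, map_sum]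
  refine Finset.sum_congr rfl fun p _ => ?_
  rw [deltaT_smul, hf, commutator_apply]
  rfl

theorem deltaSer_act_deltaSer (X Y : Ser n (K1 K V)) :
    deltaSer (act (deltaSer X) Y) = deltaSer X * deltaSer Y - deltaSer Y * deltaSer X :=
  deltaSer_act (fun α => adjointAction_deltaT (X α)) Y

/-- The Peiffer identity for series. -/
theorem deltaSer_act_eq_neg (X Y : Ser n (K1 K V)) :
    act (deltaSer X) Y = -act (deltaSer Y) X := by
  funext α
  rw [neg_ser_apply, act_apply, act_apply, ← Finset.sum_neg_distrib,
    sum_antidiagonal_swap α fun p => -(deltaSer Y p.1 • X p.2)]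
  exact Finset.sum_congr rfl fun p _ => deltaT_smul_eq_neg _ _

theorem ev_deltaForm {m : ℕ} (v : Fin m → V) (ω : Form K V n m (K1 K V)) :
    ev v (deltaForm ω) = deltaSer (ev v ω) := rfl

variable (b : Module.Basis (Fin n) K V)

theorem eta_mem_range (α : Fin n →₀ ℕ) : eta b α ∈ LinearMap.range (TensorAlgebra.ι K (M := V)) := by
  rw [eta, sum_ser_apply]
  refine Submodule.sum_mem _ fun i _ => ?_
  rw [mono]
  split_ifs
  · exact LinearMap.mem_range_self _ _
  · exact Submodule.zero_mem _

theorem deltaSer_act_eta (X : Ser n (K1 K V)) :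
    deltaSer (act (eta b) X) = eta b * deltaSer X - deltaSer X * eta b :=
  deltaSer_act (fun α => by
    obtain ⟨v, hv⟩ := eta_mem_range b α
    rw [← hv, adjointAction_ι]) X

/-- The constant series `v ∈ V ⊆ T(V)`. -/
def constVec (n : ℕ) (v : V) : Ser n (TensorAlgebra K V) := mono 0 (TensorAlgebra.ι K v)

/-- The constant series `u ∧ v ∈ 𝔨₁`. -/
def constGen (n : ℕ) (u v : V) : Ser n (K1 K V) := mono 0 (gen ![u, v])

theorem gen_swap (u v : V) : (gen ![v, u] : K1 K V) = -gen ![u, v] := by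
  have h := (gen (K := K) (V := V)).map_swap ![u, v] (i := 0) (j := 1) (by simp)
  rw [← h]
  congr 1
  ext i; fin_cases i <;> rfl

theorem gen_self (u : V) : (gen ![u, u] : K1 K V) = 0 :=
  (gen (K := K) (V := V)).map_eq_zero_of_eq ![u, u] (i := 0) (j := 1) rfl (by simp)

/-- The linear map `v ↦ u ∧ v`. -/
def genLeft (u : V) : V →ₗ[K] K1 K V where
  toFun v := gen ![u, v]
  map_add' v w := by
    have h := (gen (K := K) (V := V)).map_update_add ![u, v] 1 v w
    have hx : ∀ x, Function.update ![u, v] 1 x = ![u, x] := fun x => by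
      ext i; fin_cases i <;> rfl
    rwa [hx, hx, hx] at h
  map_smul' c v := by
    have h := (gen (K := K) (V := V)).map_update_smul ![u, v] 1 c v
    have hx : ∀ x, Function.update ![u, v] 1 x = ![u, x] := fun x => by
      ext i; fin_cases i <;> rfl
    rwa [hx, hx] at h

theorem genLeft_apply (u v : V) : genLeft (K := K) u v = gen ![u, v] := rfl

theorem sum_lt_add_swap {N : Type*} [AddCommGroup N] (S : Fin n → Fin n → N)
    (h : ∀ i, S i i = 0) :
    (∑ i, ∑ j, if i < j then S i j + S j i else 0) = ∑ i, ∑ j, S i j := by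
  have h1 : ∀ i j : Fin n, S i j = (if i < j then S i j else 0) + if j < i then S i j else 0 := by
    intro i j
    rcases lt_trichotomy i j with hij | hij | hij
    · simp [hij, hij.not_gt]
    · simp [hij, h]
    · simp [hij, hij.not_gt]
  have h2 : ∀ i j : Fin n, (if i < j then S i j + S j i else 0) =
      (if i < j then S i j else 0) + if i < j then S j i else 0 := by
    intro i j
    split_ifs <;> simp
  simp only [h2, Finset.sum_add_distrib]
  conv_rhs =>
    enter [2, i, 2, j]
    rw [h1]
  simp only [Finset.sum_add_distrib]
  congr 1
  exact Finset.sum_comm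

/-- This is `U(v) = η ∧ v`: by antisymmetry of the wedge, the two halves of each `i < j` term fill
in the full double sum. -/
theorem ev_formU (v : V) :
    ev (fun _ => v) (formU b) = ∑ i, mono (Finsupp.single i 1) (gen ![b i, v]) := by
  have h1 : ∀ i : Fin n, (mono (Finsupp.single i 1) (gen ![b i, v]) : Ser n (K1 K V)) =
      ∑ j, b.coord j v • mono (Finsupp.single i 1) (gen ![b i, b j]) := by
    intro i
    have : (gen ![b i, v] : K1 K V) = ∑ j, b.coord j v • gen ![b i, b j] := by
      conv_lhs => rw [← genLeft_apply, ← b.sum_repr v, map_sum]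
      exact Finset.sum_congr rfl fun j _ => map_smul _ _ _
    funext α
    rw [sum_ser_apply, mono]
    split_ifs with hα
    · rw [this]
      exact Finset.sum_congr rfl fun j _ => by rw [smul_ser_apply, mono, if_pos hα]
    · exact (Finset.sum_eq_zero fun j _ => by rw [smul_ser_apply, mono, if_neg hα, smul_zero]).symm
  simp only [h1]
  rw [← sum_lt_add_swap (fun i j => b.coord j v • (mono (Finsupp.single i 1) (gen ![b i, b j]) : Ser n (K1 K V)))]
  · rw [formU, map_sum]
    refine Finset.sum_congr rfl fun i _ => ?_
    rw [map_sum]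
    refine Finset.sum_congr rfl fun j _ => ?_
    split_ifs
    · funext α
      have h0 : (0 : K) • (gen ![b i, b j] : K1 K V) = 0 := zero_smul K (gen ![b i, b j] : K1 K V)
      have h2 : ∀ l, dz b l (fun _ => v) = b.coord l v := fun _ => rfl
      rw [ev_tensorForm_apply, map_sub, ev_mono, ev_mono, sub_ser_apply, add_ser_apply,
        smul_ser_apply, smul_ser_apply, gen_swap (b i) (b j), h2, h2, sub_smul, sub_eq_add_neg]
      simp only [mono, ite_smul, smul_ite, smul_zero, smul_neg]
      congr 1
      · split_ifs
        · rfl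
        · exact h0
      · split_ifs
        · rfl
        · exact neg_eq_zero.2 h0
    · rfl
  · intro i
    funext α
    rw [smul_ser_apply, show (gen ![b i, b i] : K1 K V) = 0 from gen_self _, mono, ite_self, smul_zero]
    rfl

theorem mul_mono_zero_apply (f : Ser n (TensorAlgebra K V)) (a : TensorAlgebra K V)
    (α : Fin n →₀ ℕ) : (f * mono 0 a : Ser n (TensorAlgebra K V)) α = f α * a := by
  rw [← act_eq_mul, act_mono_zero_apply, smul_eq_mul]

theorem mono_zero_mul_apply (f : Ser n (TensorAlgebra K V)) (a : TensorAlgebra K V)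
    (α : Fin n →₀ ℕ) : (mono 0 a * f : Ser n (TensorAlgebra K V)) α = a * f α := by
  rw [← act_eq_mul, mono_zero_act_apply, smul_eq_mul]

theorem deltaSer_formU (v : V) :
    deltaSer (ev (fun _ => v) (formU b)) = eta b * constVec n v - constVec n v * eta b := by
  funext α
  rw [ev_formU, map_sum, sub_ser_apply, constVec, mul_mono_zero_apply, mono_zero_mul_apply, eta,
    sum_ser_apply, sum_ser_apply, Finset.sum_mul, Finset.mul_sum, ← Finset.sum_sub_distrib]
  refine Finset.sum_congr rfl fun i _ => ?_
  rw [mapSer_mono, deltaT_gen, mono, mono]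
  split_ifs <;> simp

theorem homogeneous_formU (v : V) : IsHomogeneousOf 1 (ev (fun _ => v) (formU b)) := by
  rw [ev_formU]
  refine IsHomogeneousOf.sum _ _ fun i _ => ?_
  have := homogeneous_mono (Finsupp.single i 1) (gen ![b i, v] : K1 K V)
  rwa [Finsupp.degree_single] at this

theorem ev_iterate_act {m : ℕ} (v : Fin m → V) (f : Ser n (TensorAlgebra K V))
    (ω : Form K V n m (K1 K V)) (k : ℕ) : ev v ((act f)^[k] ω) = (act f)^[k] (ev v ω) := by
  induction k with
  | zero => rfl
  | succ k ih => rw [Function.iterate_succ_apply', Function.iterate_succ_apply', ev_act, ih]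

variable [CharZero K]

/-- From `(k+1)/(k+2)! = 1/(k+1)! - 1/(k+2)!`. Each of the two series satisfies a closed Euler
equation, while `Θ` alone does not. -/
theorem ev_bigTheta (v : V) :
    ev (fun _ => v) (bigTheta b) =
      expSum (fun k => (((k + 2).factorial : K)⁻¹)) (eta b) (ev (fun _ => v) (formU b)) -
        expSum (fun k => (((k + 1).factorial : K)⁻¹)) (eta b) (ev (fun _ => v) (formU b)) := by
  funext α
  rw [sub_ser_apply, expSum, expSum, ← Finset.sum_sub_distrib, ev_apply, bigTheta,
    AlternatingMap.neg_apply, alternatingMap_sum_apply, ← Finset.sum_neg_distrib]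
  refine Finset.sum_congr rfl fun k _ => ?_
  rw [← sub_smul, ← ev_iterate_act, AlternatingMap.smul_apply]
  suffices h : -(((k : K) + 1) / ((k + 2).factorial : K)) =
      ((k + 2).factorial : K)⁻¹ - ((k + 1).factorial : K)⁻¹ by
    rw [← h]
    exact (neg_smul (((k : K) + 1) / ((k + 2).factorial : K))
      (ev (fun _ => v) ((act (eta b))^[k] (formU b)) α)).symm
  have h1 : ((k + 1).factorial : K) ≠ 0 := Nat.cast_ne_zero.2 (Nat.factorial_ne_zero _)
  have h2 : ((k + 2 : ℕ) : K) ≠ 0 := Nat.cast_ne_zero.2 (Nat.succ_ne_zero _)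
  rw [Nat.factorial_succ (k + 1), Nat.cast_mul]
  push_cast at h2 ⊢
  have h3 : (k : K) + 1 + 1 ≠ 0 := by rwa [add_assoc, one_add_one_eq_two]
  field_simp
  ring

/-- `δ(Θ) θ = dθ - θ ζ₀`. -/
theorem deltaSer_bigTheta_mul_theta (v : V) :
    deltaSer (ev (fun _ => v) (bigTheta b)) * theta b =
      lieDeriv b v (theta b) - theta b * constVec n v := by
  set U := ev (fun _ => v) (formU b) with hU
  set F1 := expSum (fun k => (((k + 1).factorial : K)⁻¹)) (eta b) U with hF1
  set F2 := expSum (fun k => (((k + 2).factorial : K)⁻¹)) (eta b) U with hF2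
  set e : Ser n (TensorAlgebra K V) := constVec n v with he
  have hηe : deltaSer U = eta b * e - e * eta b := deltaSer_formU b v
  have hEe : euler e = 0 := euler_mono_zero _
  have hE1 : euler F1 = U + act (eta b) F1 := by
    have h := euler_expSum (fun k => (((k + 1).factorial : K)⁻¹)) (homogeneous_eta b)
      (homogeneous_formU b v) 0 (fun k => by
        have : ((k + 1 + 1 : ℕ) : K) ≠ 0 := Nat.cast_ne_zero.2 (Nat.succ_ne_zero _)
        rw [Nat.factorial_succ (k + 1), Nat.cast_mul, mul_inv, add_zero, mul_inv_cancel_left₀ this])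
    simpa using h
  have hE2 : euler F2 + F2 = U + act (eta b) F2 := by
    have h := euler_expSum (fun k => (((k + 2).factorial : K)⁻¹)) (homogeneous_eta b)
      (homogeneous_formU b v) 1 (fun k => by
        have : ((k + 2 + 1 : ℕ) : K) ≠ 0 := Nat.cast_ne_zero.2 (Nat.succ_ne_zero _)
        rw [show k + 1 + 2 = k + 2 + 1 by ring, Nat.factorial_succ (k + 2), Nat.cast_mul, mul_inv,
          show k + 1 + 1 + 1 = k + 2 + 1 by ring, mul_inv_cancel_left₀ this])
    simpa [one_add_one_eq_two] using h
  have hD1 : euler (deltaSer F1) =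
      eta b * e - e * eta b + (eta b * deltaSer F1 - deltaSer F1 * eta b) := by
    rw [euler_mapSer, hE1, map_add, hηe, deltaSer_act_eta]
  have hD2 : euler (deltaSer F2) + deltaSer F2 =
      eta b * e - e * eta b + (eta b * deltaSer F2 - deltaSer F2 * eta b) := by
    rw [euler_mapSer, ← map_add, hE2, map_add, hηe, deltaSer_act_eta]
  have hU0 : U 0 = 0 := homogeneous_formU b v 0 (by simp)
  -- This says `δ(F1) = θ v θ⁻¹ - v`. In the Euler equation, the summand `-δ(F1) η θ` from the
  -- commutator cancels `δ(F1) Eθ`, leaving left multiplication by `η`.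
  have key1 : deltaSer F1 * theta b - (theta b * e - e * theta b) = 0 := by
    refine eq_zero_of_euler (K := K) (eta_zero b) 0 ?_ fun _ => ?_
    · rw [act_eq_mul, zero_smul, add_zero]
      simp only [map_sub, euler_mul, hD1, hEe, euler_theta]
      noncomm_ring
    · have h1 : F1 0 = 0 := by simp [hF1, expSum, hU0]
      have h2 : (deltaSer F1 * theta b) 0 = deltaSer F1 0 * theta b 0 := by
        rw [← act_eq_mul, act_apply]
        simp
      rw [sub_ser_apply, sub_ser_apply, h2, mapSer_apply, h1, he, constVec, mul_mono_zero_apply,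
        mono_zero_mul_apply, theta_zero]
      simp
  -- Here `c = 1`, since `L_v` lowers degree by one and `F2` satisfies the shifted equation; no
  -- constant term has to be checked.
  have key2 : deltaSer F2 * theta b - (lieDeriv b v (theta b) - e * theta b) = 0 := by
    refine eq_zero_of_euler (K := K) (eta_zero b) 1 ?_ fun h => absurd h one_ne_zero
    have hD2' : euler (deltaSer F2) =
      eta b * e - e * eta b + (eta b * deltaSer F2 - deltaSer F2 * eta b) - deltaSer F2 :=
      eq_sub_of_add_eq hD2
    have hη : lieDeriv b v (eta b) = e := lieDeriv_eta b v
    rw [act_eq_mul, one_smul]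
    simp only [map_sub, euler_mul, hD2', hEe, euler_theta, euler_lieDeriv, lieDeriv_mul, hη]
    noncomm_ring
  rw [ev_bigTheta, map_sub, sub_mul, sub_eq_zero.1 key1, sub_eq_zero.1 key2]
  abel

omit [CharZero K] in
theorem gaugeZero_universal_mul_theta (v : V) :
    ev (fun _ => v) (gaugeZero b (theta b) (universalConnection K V n)).1 * theta b =
      theta b * constVec n v - lieDeriv b v (theta b) := by
  have h1 : Ring.inverse (theta b) * theta b = 1 := Ring.inverse_mul_cancel _ (isUnit_theta b)
  have h2 : theta b * Ring.inverse (theta b) = 1 := Ring.mul_inverse_cancel _ (isUnit_theta b)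
  -- The derivative of `θ θ⁻¹ = 1`, which expresses `θ d(θ⁻¹)` through `dθ`.
  have h3 : lieDeriv b v (theta b) * Ring.inverse (theta b) +
      theta b * lieDeriv b v (Ring.inverse (theta b)) = 0 := by
    rw [← lieDeriv_mul, h2, one_eq_mono, lieDeriv_mono_zero]
  have h4 : ev (fun _ => v) (universalConnection K V n).1 = constVec n v :=
    mapSer_mono _ _ _
  rw [gaugeZero, map_add, ev_act, ev_dFun, ev_rightMul, ev_act, h4, act_eq_mul, act_eq_mul,
    eq_neg_of_add_eq_zero_right h3, add_mul, neg_mul, mul_assoc, h1, mul_assoc _ _ (theta b), h1,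
    mul_one, mul_one]
  abel

theorem ev_gaugeZero_fst (v : V) :
    ev (fun _ => v) (gaugeZero b (theta b) (universalConnection K V n)).1 =
      -deltaSer (ev (fun _ => v) (bigTheta b)) := by
  refine (isUnit_theta b).mul_right_cancel ?_
  rw [gaugeZero_universal_mul_theta, neg_mul, deltaSer_bigTheta_mul_theta, neg_sub]

theorem abelianized_fst : (abelianized b).1 = 0 := by
  refine form_ext fun v => ?_
  rw [eq_const v, abelianized, gaugeOne, map_add, ev_deltaForm, ev_gaugeZero_fst, neg_add_cancel,
    map_zero]

end Abelianization

/-! ### The abelianized 2-connection and its 2-curvature -/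

section AbelianizedCurvature

variable {K V : Type*} [Field K] [AddCommGroup V] [Module K V] {n : ℕ}
variable (b : Module.Basis (Fin n) K V)

/-- The values of `Θ`. -/
abbrev thetaOne (v : V) : Ser n (K1 K V) := ev (fun _ => v) (bigTheta b)

theorem euler_constGen (u v : V) : euler (constGen (K := K) n u v) = 0 := euler_mono_zero _

/-- `δ(θ ▷ (u ∧ v)) θ = θ [u, v]`. -/
theorem deltaSer_act_theta_mul_theta [CharZero K] (u v : V) :
    deltaSer (act (theta b) (constGen n u v)) * theta b =
      theta b * (constVec n u * constVec n v - constVec n v * constVec n u) := by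
  have h1 : euler (deltaSer (act (theta b) (constGen n u v))) =
      eta b * deltaSer (act (theta b) (constGen n u v)) -
        deltaSer (act (theta b) (constGen n u v)) * eta b := by
    rw [euler_mapSer, euler_act, euler_constGen, act_zero, add_zero, euler_theta, ← act_act,
      deltaSer_act_eta]
  have hE : ∀ v : V, euler (constVec (K := K) n v) = 0 := fun v => euler_mono_zero _
  rw [← sub_eq_zero]
  refine eq_zero_of_euler (K := K) (eta_zero b) 0 ?_ fun _ => ?_
  · rw [act_eq_mul, zero_smul, add_zero]
    simp only [map_sub, euler_mul, h1, hE, euler_theta]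
    noncomm_ring
  · have h0 : ∀ f g : Ser n (TensorAlgebra K V), (f * g) 0 = f 0 * g 0 := fun f g => by
      rw [← act_eq_mul, act_apply]
      simp
    rw [sub_ser_apply, h0, h0, sub_ser_apply, h0, h0, theta_zero, mapSer_apply, constGen,
      act_mono_zero_apply, theta_zero, one_smul, deltaT_gen]
    simp [constVec, mono]

theorem deltaSer_act_thetaOne_comm (u v : V) :
    act (deltaSer (thetaOne b u)) (thetaOne b v) =
      -act (deltaSer (thetaOne b v)) (thetaOne b u) :=
  deltaSer_act_eq_neg _ _

variable [CharZero K]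

/-- The connection form entering the second gauge step is `-δΘ`. By the Peiffer identity its wedge
with `Θ` contributes `-2 δ(Θ_u) ▷ Θ_v` and the half bracket contributes `+1` times the same term. -/
theorem ev_abelianized_snd (u v : V) :
    ev ![u, v] (abelianized b).2 =
      act (theta b) (constGen n u v) +
        (lieDeriv b u (thetaOne b v) - lieDeriv b v (thetaOne b u)) -
          act (deltaSer (thetaOne b u)) (thetaOne b v) := by
  have h1 : ev ![u, v] (act (theta b) (universalConnection K V n).2) =
      act (theta b) (constGen n u v) := by
    rw [ev_act]
    exact congrArg _ (mapSer_mono _ _ _)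
  have h2 : (2⁻¹ : K) • (act (deltaSer (thetaOne b u)) (thetaOne b v) -
      act (deltaSer (thetaOne b v)) (thetaOne b u)) =
        act (deltaSer (thetaOne b u)) (thetaOne b v) := by
    rw [deltaSer_act_thetaOne_comm b v u, sub_neg_eq_add, ← two_smul K, smul_smul,
      inv_mul_cancel₀ two_ne_zero, one_smul]
  have h3 : ev ![u, v] (abelianized b).2 =
      act (theta b) (constGen n u v) +
        (lieDeriv b u (thetaOne b v) - lieDeriv b v (thetaOne b u)) +
          (act (-deltaSer (thetaOne b u)) (thetaOne b v) -
            act (-deltaSer (thetaOne b v)) (thetaOne b u)) +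
              (2⁻¹ : K) • (act (deltaSer (thetaOne b u)) (thetaOne b v) -
                act (deltaSer (thetaOne b v)) (thetaOne b u)) := by
    rw [← h1, ← ev_d_one, ← ev_gaugeZero_fst, ← ev_gaugeZero_fst, ← ev_wedge_one,
      ← ev_deltaForm, ← ev_deltaForm, ← ev_wedge_one]
    rfl
  rw [h3, h2, neg_act, neg_act, deltaSer_act_thetaOne_comm b v u]
  abel

/-- A Maurer–Cartan computation: differentiate `δ(Θ_v)θ = L_v θ - θv` along `u` and antisymmetrize.
Second derivatives of `θ` cancel, and the remaining `θ[u, v]` is `δ(θ ▷ (u ∧ v))θ`. Multiplying by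
the unit `θ` avoids derivatives of `θ⁻¹`. -/
theorem deltaSer_abelianized_snd (u v : V) : deltaSer (ev ![u, v] (abelianized b).2) = 0 := by
  refine (isUnit_theta b).mul_right_cancel ?_
  have hD : ∀ v : V, deltaSer (thetaOne b v) * theta b =
      lieDeriv b v (theta b) - theta b * constVec n v := deltaSer_bigTheta_mul_theta b
  have hL : ∀ u v : V, lieDeriv b u (deltaSer (thetaOne b v)) * theta b =
      lieDeriv b u (lieDeriv b v (theta b)) - lieDeriv b u (theta b) * constVec n v -
        deltaSer (thetaOne b v) * lieDeriv b u (theta b) := by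
    intro u v
    have h : lieDeriv b u (constVec (K := K) n v) = 0 := lieDeriv_mono_zero b u _
    have := congrArg (lieDeriv b u) (hD v)
    rw [lieDeriv_mul, map_sub, lieDeriv_mul, h, mul_zero, add_zero] at this
    exact eq_sub_of_add_eq this
  rw [ev_abelianized_snd, map_sub, map_add, map_sub, ← lieDeriv_mapSer, ← lieDeriv_mapSer,
    deltaSer_act_deltaSer, sub_mul, add_mul, sub_mul, hL, hL, deltaSer_act_theta_mul_theta, sub_mul,
    mul_assoc, mul_assoc (deltaSer (thetaOne b v)), hD, hD, lieDeriv_comm b v u]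
  simp only [mul_sub, ← mul_assoc, hD, sub_mul]
  rw [zero_mul]
  abel

theorem abelianized_snd_mem (α : Fin n →₀ ℕ) (v : Fin 2 → V) :
    (abelianized b).2 α v ∈ A1 K V := by
  rw [mem_A1_iff, eq_vec2 v]
  exact congrFun (deltaSer_abelianized_snd b (v 0) (v 1)) α

/-- Elements of `𝔞₁`-valued series are killed by the image of `δ`. -/
theorem deltaSer_act_abelianized_snd (X : Ser n (K1 K V)) (u v : V) :
    act (deltaSer X) (ev ![u, v] (abelianized b).2) = 0 := by
  rw [deltaSer_act_eq_neg, deltaSer_abelianized_snd, zero_act, neg_zero]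

theorem Kab_eq_d : Kab b = d b (abelianized b).2 := by
  have : wedge (abelianized b).1 (abelianized b).2 = 0 := by
    rw [abelianized_fst]
    funext α
    refine Finset.sum_eq_zero fun p _ => AlternatingMap.ext fun v => ?_
    rw [constWedge, AlternatingMap.alternatizeUncurryFin_apply]
    refine Finset.sum_eq_zero fun i _ => ?_
    refine (congrArg _ ?_).trans (smul_zero _)
    exact zero_smul (TensorAlgebra K V) ((abelianized b).2 p.2 (i.removeNth v))
  rw [Kab, twoCurvature, this, add_zero]

theorem d_Kab : d b (Kab b) = 0 := by
  rw [Kab_eq_d, d_d]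

/-- The value of `ζ₀ ∧ ζ₁` on three constant vector fields. -/
def wedgeUniversal (u v w : V) : K1 K V :=
  TensorAlgebra.ι K u • gen ![v, w] - TensorAlgebra.ι K v • gen ![u, w] +
    TensorAlgebra.ι K w • gen ![u, v]

/-- The shape required by `alternating_sum_eq`: `L_u θ` is replaced by `δ(Θ_u)θ + θu`, and the
Peiffer identity moves each derivative from inside `δ` to the element acted upon. -/
theorem lieDeriv_abelianized_snd (u v w : V) :
    lieDeriv b u (ev ![v, w] (abelianized b).2) =
      act (theta b * constVec n u) (constGen n v w) +
        act (deltaSer (thetaOne b u)) (act (theta b) (constGen n v w)) +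
          (lieDeriv b u (lieDeriv b v (thetaOne b w)) -
            lieDeriv b u (lieDeriv b w (thetaOne b v))) +
              (act (deltaSer (thetaOne b w)) (lieDeriv b u (thetaOne b v)) -
                act (deltaSer (thetaOne b v)) (lieDeriv b u (thetaOne b w))) := by
  have h1 : lieDeriv b u (act (theta b) (constGen (K := K) n v w)) =
      act (lieDeriv b u (theta b)) (constGen n v w) := by
    have h : lieDeriv b u (constGen (K := K) n v w) = 0 := lieDeriv_mono_zero b u _
    rw [lieDeriv_act, h, act_zero, add_zero]
  have h2 : lieDeriv b u (act (deltaSer (thetaOne b v)) (thetaOne b w)) =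
      -act (deltaSer (thetaOne b w)) (lieDeriv b u (thetaOne b v)) +
        act (deltaSer (thetaOne b v)) (lieDeriv b u (thetaOne b w)) :=
    (lieDeriv_act b u _ _).trans (congrArg (· + _)
      ((congrArg (fun f => act f (thetaOne b w)) (lieDeriv_mapSer b u deltaT (thetaOne b v))).trans
        (deltaSer_act_eq_neg _ _)))
  have h3 : act (deltaSer (thetaOne b u)) (act (theta b) (constGen n v w)) =
      act (lieDeriv b u (theta b)) (constGen n v w) -
        act (theta b * constVec n u) (constGen n v w) :=
    (act_act _ _ _).trans ((congrArg (act · (constGen (K := K) n v w))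
      (deltaSer_bigTheta_mul_theta b u)).trans (sub_act _ _ _))
  rw [ev_abelianized_snd, map_sub, map_add, map_sub, h1, h2, h3]
  abel

omit [CharZero K] in
-- Jacobi identity in `𝔨₁`: the commutator of `δ(Θ_u)` and `δ(Θ_v)` is `δ(δ(Θ_u) ▷ Θ_v)`, and the
-- Peiffer identity turns it around.
theorem act_act_thetaOne (u v w : V) :
    act (deltaSer (thetaOne b u)) (act (deltaSer (thetaOne b v)) (thetaOne b w)) -
      act (deltaSer (thetaOne b v)) (act (deltaSer (thetaOne b u)) (thetaOne b w)) =
        -act (deltaSer (thetaOne b w)) (act (deltaSer (thetaOne b u)) (thetaOne b v)) := by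
  rw [act_act, act_act, ← sub_act, ← deltaSer_act_deltaSer, deltaSer_act_eq_neg]

/-- The cancellation in `dζ₁^ab`, isolated in an abelian group. The second derivatives `D` cancel by
symmetry, the `Q` terms of `L` cancel those of `Z`, and the cubic terms `T` vanish by Jacobi; only
`Y` survives. -/
theorem alternating_sum_eq {W G : Type*} [AddCommGroup G] (L Y Z D Q T : W → W → W → G)
    (hL : ∀ u v w, L u v w = Y u v w + Z u v w + (D u v w - D u w v) + (Q w u v - Q v u w))
    (hD : ∀ u v w, D u v w = D v u w) (hZ : ∀ u v w, Z u v w = -(Q u v w - Q u w v) + T u v w)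
    (hT : ∀ u v w, T u v w - T v u w = -T w u v) (u v w : W) :
    L u v w - L v u w + L w u v = Y u v w - Y v u w + Y w u v := by
  rw [hL u, hL v, hL w, hZ u, hZ v, hZ w, hD v u w, hD w u v, hD w v u,
    sub_eq_iff_eq_add.1 (hT u v w)]
  abel

/-- The central formula `𝒦^ab = θ ▷ (ζ₀ ∧ ζ₁)`: the 1-form `Θ` leaves no trace in the curvature. -/
theorem ev_Kab (u v w : V) :
    ev ![u, v, w] (Kab b) = act (theta b) (mono 0 (wedgeUniversal u v w)) := by
  -- This is `δ(Θ_u) ▷ ζ₁^ab(v, w) = 0`, solved for its `θ` term.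
  have hZ : ∀ u v w : V, act (deltaSer (thetaOne b u)) (act (theta b) (constGen n v w)) =
      -(act (deltaSer (thetaOne b u)) (lieDeriv b v (thetaOne b w)) -
        act (deltaSer (thetaOne b u)) (lieDeriv b w (thetaOne b v))) +
          act (deltaSer (thetaOne b u)) (act (deltaSer (thetaOne b v)) (thetaOne b w)) := by
    intro u v w
    have h := deltaSer_act_abelianized_snd b (thetaOne b u) v w
    rw [ev_abelianized_snd, act_sub, act_add, act_sub] at h
    rw [sub_eq_zero] at h
    rw [← h]
    abel
  have hR : act (theta b) (mono 0 (wedgeUniversal u v w)) =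
      act (theta b * constVec n u) (constGen (K := K) n v w) -
        act (theta b * constVec n v) (constGen (K := K) n u w) +
          act (theta b * constVec n w) (constGen (K := K) n u v) := by
    rw [← act_act, ← act_act, ← act_act, ← act_sub, ← act_add]
    congr 1
    funext α
    rw [add_ser_apply, sub_ser_apply, constVec, constVec, constVec, mono_zero_act_apply,
      mono_zero_act_apply, mono_zero_act_apply, constGen, constGen, constGen, wedgeUniversal]
    simp only [mono]
    split_ifs
    · rfl
    · rw [smul_zero, smul_zero, smul_zero, sub_zero, add_zero]
  refine Eq.trans ?_ hR.symm
  rw [Kab_eq_d, ev_d_two]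
  exact alternating_sum_eq
    (fun u v w => lieDeriv b u (ev ![v, w] (abelianized b).2))
    (fun u v w => act (theta b * constVec n u) (constGen n v w))
    (fun u v w => act (deltaSer (thetaOne b u)) (act (theta b) (constGen n v w)))
    (fun u v w => lieDeriv b u (lieDeriv b v (thetaOne b w)))
    (fun u v w => act (deltaSer (thetaOne b u)) (lieDeriv b v (thetaOne b w)))
    (fun u v w => act (deltaSer (thetaOne b u)) (act (deltaSer (thetaOne b v)) (thetaOne b w)))
    (lieDeriv_abelianized_snd b) (fun u v w => lieDeriv_comm b u v (thetaOne b w)) hZ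
    (act_act_thetaOne b) u v w

theorem Kab_apply (α : Fin n →₀ ℕ) (u v w : V) :
    Kab b α ![u, v, w] = theta b α • wedgeUniversal u v w := by
  rw [← ev_apply, ev_Kab, act_mono_zero_apply]

omit [CharZero K] in
-- Under `δ` this becomes the Jacobi identity for `u`, `v`, `w`.
theorem wedgeUniversal_mem (u v w : V) : (wedgeUniversal u v w : K1 K V) ∈ A1 K V := by
  rw [mem_A1_iff, wedgeUniversal, map_add, map_sub, deltaT_smul, deltaT_smul, deltaT_smul,
    adjointAction_ι, adjointAction_ι, adjointAction_ι, deltaT_gen, deltaT_gen, deltaT_gen,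
    commutator_apply, commutator_apply, commutator_apply]
  noncomm_ring

theorem Kab_mem (α : Fin n →₀ ℕ) (v : Fin 3 → V) : Kab b α v ∈ A1 K V := by
  rw [eq_vec3 v, Kab_apply]
  exact smul_mem_A1 _ (wedgeUniversal_mem _ _ _)

end AbelianizedCurvature

/-! ### The pairing of the 2-curvature with polynomial forms -/

section PairingCurvature

variable {K V : Type*} [Field K] [AddCommGroup V] [Module K V] {n : ℕ}
variable (b : Module.Basis (Fin n) K V)

theorem degree_eq_sum (α : Fin n →₀ ℕ) : α.degree = ∑ i, α i := by
  rw [Finsupp.degree_apply]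
  exact Finset.sum_subset (Finset.subset_univ _) fun i _ hi => by simpa using hi

theorem sub_single_add_single {α : Fin n →₀ ℕ} {i : Fin n} (h : 0 < α i) :
    α - Finsupp.single i 1 + Finsupp.single i 1 = α :=
  tsub_add_cancel_of_le (by simpa using Nat.succ_le_of_lt h)

theorem degree_sub_single_lt {α : Fin n →₀ ℕ} {i : Fin n} (h : 0 < α i) :
    (α - Finsupp.single i 1).degree < α.degree := by
  have h1 := congrArg Finsupp.degree (sub_single_add_single h)
  rw [map_add, Finsupp.degree_single] at h1
  omega

/-- The recursion for the coefficients of `θ = exp(η)`. -/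
theorem degree_smul_theta [CharZero K] (α : Fin n →₀ ℕ) :
    α.degree • theta b α =
      ∑ i, if 0 < α i then TensorAlgebra.ι K (b i) * theta b (α - Finsupp.single i 1) else 0 := by
  rw [← euler_apply, euler_theta, ← act_eq_mul, act_eta_apply]
  rfl

/-- Taylor's formula. -/
theorem symAction_theta_apply_zero [CharZero K] (α : Fin n →₀ ℕ) (f : Ser n K) :
    symAction b (SymmetricAlgebra.algHom K V (theta b α)) f 0 = f α := by
  suffices h : ∀ r, ∀ α : Fin n →₀ ℕ, α.degree = r → ∀ f : Ser n K,
      symAction b (SymmetricAlgebra.algHom K V (theta b α)) f 0 = f α from h _ α rfl f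
  intro r
  induction r using Nat.strong_induction_on with
  | _ r ih =>
    intro α hα f
    by_cases h0 : α = 0
    · rw [h0, theta_zero, map_one, map_one]
      rfl
    have hd : ((α.degree : ℕ) : K) ≠ 0 :=
      Nat.cast_ne_zero.2 fun h => h0 ((Finsupp.degree_eq_zero_iff α).1 h)
    let φ : TensorAlgebra K V →ₗ[K] K := LinearMap.proj (R := K) (φ := fun _ : Fin n →₀ ℕ => K) 0 ∘ₗ
      LinearMap.applyₗ f ∘ₗ (symAction b).toLinearMap ∘ₗ (SymmetricAlgebra.algHom K V).toLinearMap
    have hφ : ∀ a, φ a = symAction b (SymmetricAlgebra.algHom K V a) f 0 := fun _ => rfl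
    -- By the recursion for `θ_α` and induction, the `i`-th summand contributes `αᵢ f_α`.
    -- Commutativity of `S(V)` lets `eᵢ` act on `f` first, so that the induction hypothesis applies
    -- to `∂ᵢ f`.
    have key : α.degree • φ (theta b α) = α.degree • f α := by
      rw [← map_nsmul, degree_smul_theta, map_sum, degree_eq_sum, Finset.sum_smul]
      refine Finset.sum_congr rfl fun i _ => ?_
      split_ifs with hi
      · have h1 : SymmetricAlgebra.algHom K V (TensorAlgebra.ι K (b i)) =
            SymmetricAlgebra.ι K V (b i) := rfl
        rw [hφ, map_mul, mul_comm, map_mul, Module.End.mul_apply, h1, symAction_ι,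
          ih _ (hα ▸ degree_sub_single_lt hi) _ rfl, lieDeriv_basis, pderiv_apply,
          sub_single_add_single hi]
        congr 1
        have := DFunLike.congr_fun (sub_single_add_single hi) i
        simpa using this
      · rw [map_zero, Nat.eq_zero_of_not_pos hi, zero_smul]
    rw [← Nat.cast_smul_eq_nsmul K, ← Nat.cast_smul_eq_nsmul K] at key
    exact smul_right_injective K hd key

/-- The series `L_{u₁} ⋯ L_{u_r} ι_{v₁} ι_{v₂} ξ`, whose value at the origin is the pairing. -/
def pairingSer (ξ : Form K V n 2 K) : Currents K V →ₗ[K] Ser n K :=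
  TensorProduct.lift ((symAction b).toLinearMap.compl₂ (contract ξ))

theorem pairing_apply (ξ : Form K V n 2 K) (c : Currents K V) :
    pairing b ξ c = pairingSer b ξ c 0 := rfl

theorem pairingSer_smul (ξ : Form K V n 2 K) (s : SymmetricAlgebra K V) (c : Currents K V) :
    pairingSer b ξ (s • c) = symAction b s (pairingSer b ξ c) := by
  induction c using TensorProduct.induction_on with
  | zero => rw [smul_zero, map_zero, map_zero]
  | tmul t w =>
    rw [TensorProduct.smul_tmul', smul_eq_mul]
    change symAction b (s * t) (contract ξ w) = symAction b s (symAction b t (contract ξ w))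
    rw [map_mul, Module.End.mul_apply]
  | add x y hx hy => rw [smul_add, map_add, hx, hy, map_add, map_add]

theorem rho_mk (X : FreeRep K V) : rho ((peiffer K V).mkQ X) =
    (SymmetricAlgebra.algHom K V).toLinearMap.rTensor (⋀[K]^2 V) X := rfl

theorem rho_smul (a : TensorAlgebra K V) (X : K1 K V) :
    rho (a • X) = SymmetricAlgebra.algHom K V a • rho X := by
  obtain ⟨X, rfl⟩ := (peiffer K V).mkQ_surjective X
  rw [← map_smul, rho_mk, rho_mk, symmetrize_smul]

/-- The sign comes from `ι_u ι_v ξ = ξ(v, u)`. -/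
theorem pairingSer_rho_gen (ξ : Form K V n 2 K) (u v : V) :
    pairingSer b ξ (rho (gen ![u, v])) = -ev ![u, v] ξ := by
  have h : rho (gen ![u, v] : K1 K V) = 1 ⊗ₜ[K] exteriorPower.ιMulti K 2 ![u, v] := by
    refine (rho_mk _).trans ?_
    rw [TensorProduct.mk_apply, LinearMap.rTensor_tmul, AlgHom.toLinearMap_apply, map_one]
    rfl
  rw [h]
  change symAction b 1 (contract ξ _) = _
  rw [map_one, Module.End.one_apply]
  funext α
  change -(exteriorPower.alternatingMapLinearEquiv (ξ α) _) = _
  rw [exteriorPower.alternatingMapLinearEquiv_apply_ιMulti]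
  rfl

/-- `ρ` turns left multiplication by `u` into `L_u`, which reproduces the formula for `dξ`. The sign
left over is the one built into `⟨·,·⟩_cl`. -/
theorem pairingSer_rho_wedgeUniversal (ξ : Form K V n 2 K) (u v w : V) :
    pairingSer b ξ (rho (wedgeUniversal u v w)) = -ev ![u, v, w] (d b ξ) := by
  have h : ∀ u : V, SymmetricAlgebra.algHom K V (TensorAlgebra.ι K u) =
    SymmetricAlgebra.ι K V u := fun _ => rfl
  rw [wedgeUniversal, map_add, map_sub, rho_smul, rho_smul, rho_smul, map_add, map_sub,
    pairingSer_smul, pairingSer_smul, pairingSer_smul, h, h, h, symAction_ι, symAction_ι,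
    symAction_ι, pairingSer_rho_gen, pairingSer_rho_gen, pairingSer_rho_gen, ev_d_two, map_neg,
    map_neg, map_neg]
  abel

theorem mapForm_pairing_Kab [CharZero K] (ξ : Form K V n 2 K) :
    mapForm (-pairing b ξ ∘ₗ rho) (Kab b) = d b ξ := by
  funext α
  refine AlternatingMap.ext fun v => ?_
  rw [eq_vec3 v]
  change (-pairing b ξ) (rho (Kab b α ![v 0, v 1, v 2])) = _
  rw [Kab_apply, rho_smul, LinearMap.neg_apply, pairing_apply, pairingSer_smul,
    pairingSer_rho_wedgeUniversal, symAction_theta_apply_zero]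
  exact neg_neg _

end PairingCurvature

/-! ### The polynomial Poincaré lemma for closed `3`-forms -/

section Poincare

variable {K V : Type*} [Field K] [AddCommGroup V] [Module K V] {n : ℕ}
variable (b : Module.Basis (Fin n) K V)

theorem removeNth_quadruple {W : Type*} (t u v w : W) :
    (0 : Fin 4).removeNth ![t, u, v, w] = ![u, v, w] ∧
      (1 : Fin 4).removeNth ![t, u, v, w] = ![t, v, w] ∧
        (2 : Fin 4).removeNth ![t, u, v, w] = ![t, u, w] ∧
          (3 : Fin 4).removeNth ![t, u, v, w] = ![t, u, v] := by
  refine ⟨?_, ?_, ?_, ?_⟩ <;> ext i <;> fin_cases i <;> rfl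

theorem ev_d_three (t u v w : V) (ω : Form K V n 3 K) :
    ev ![t, u, v, w] (d b ω) =
      lieDeriv b t (ev ![u, v, w] ω) - lieDeriv b u (ev ![t, v, w] ω) +
        lieDeriv b v (ev ![t, u, w] ω) - lieDeriv b w (ev ![t, u, v] ω) := by
  rw [ev_d, Fin.sum_univ_four, (removeNth_quadruple t u v w).1, (removeNth_quadruple t u v w).2.1,
    (removeNth_quadruple t u v w).2.2.1, (removeNth_quadruple t u v w).2.2.2]
  simp [sub_eq_add_neg, pow_succ]

/-- The contraction `ι_v ω`. -/
def contractLeft (v : V) (ω : Form K V n 3 K) : Form K V n 2 K := fun α => (ω α).curryLeft v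

/-- The multiplication by the coordinate `zᵢ`. -/
def coordMul (i : Fin n) (f : Ser n K) : Ser n K := act (mono (Finsupp.single i 1) (1 : K)) f

theorem coordMul_apply (i : Fin n) (f : Ser n K) (α : Fin n →₀ ℕ) :
    coordMul i f α = if 0 < α i then f (α - Finsupp.single i 1) else 0 := by
  rw [coordMul, mono_act_apply]
  simp

theorem lieDeriv_coordMul (u : V) (i : Fin n) (f : Ser n K) :
    lieDeriv b u (coordMul i f) = b.coord i u • f + coordMul i (lieDeriv b u f) := by
  have h : lieDeriv b u (mono (Finsupp.single i 1) (1 : K)) = mono 0 (b.coord i u) := by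
    rw [lieDeriv_eq_sum, Finset.sum_eq_single i]
    · funext α
      rw [smul_ser_apply, pderiv_apply, mono, mono]
      by_cases hα : α = 0 <;> simp [hα]
    · intro j _ hj
      funext α
      rw [smul_ser_apply, pderiv_apply, mono, if_neg, smul_zero, smul_zero]
      · rfl
      · intro h
        have := DFunLike.congr_fun h j
        simp [hj] at this
    · simp
  rw [coordMul, lieDeriv_act, h]
  congr 1
  funext α
  rw [mono_zero_act_apply]
  rfl

theorem sum_coordMul_pderiv (f : Ser n K) : ∑ i, coordMul i (pderiv K i f) = euler f := by
  funext α
  rw [sum_ser_apply, euler_apply, degree_eq_sum, Finset.sum_smul]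
  refine Finset.sum_congr rfl fun i _ => ?_
  rw [coordMul_apply]
  split_ifs with hi
  · rw [pderiv_apply, sub_single_add_single hi]
    congr 1
    have := DFunLike.congr_fun (sub_single_add_single hi) i
    simpa using this
  · rw [Nat.eq_zero_of_not_pos hi, zero_smul]

/-- The contraction of a `3`-form with the Euler vector field. -/
def contractEuler (ω : Form K V n 3 K) : Form K V n 2 K :=
  ∑ i, act (mono (Finsupp.single i 1) (1 : K)) (contractLeft (b i) ω)

theorem ev_contractEuler (v w : V) (ω : Form K V n 3 K) :
    ev ![v, w] (contractEuler b ω) = ∑ i, coordMul i (ev ![b i, v, w] ω) := by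
  rw [contractEuler, map_sum]
  refine Finset.sum_congr rfl fun i _ => ?_
  rw [ev_act]
  rfl

theorem sum_coord_smul_ev (u v w : V) (ω : Form K V n 3 K) :
    ∑ i, b.coord i u • ev ![b i, v, w] ω = ev ![u, v, w] ω := by
  funext α
  let φ : V →ₗ[K] K := evalAt ![v, w] ∘ₗ (ω α).curryLeft
  have h := congrArg φ (b.sum_repr u)
  rw [map_sum] at h
  rw [sum_ser_apply]
  refine Eq.trans ?_ h
  exact Finset.sum_congr rfl fun i _ => (map_smul φ _ _).symm

/-- Cartan's formula for a closed `3`-form. -/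
theorem d_contractEuler {ω : Form K V n 3 K} (hω : d b ω = 0) (u v w : V) :
    ev ![u, v, w] (d b (contractEuler b ω)) =
      euler (ev ![u, v, w] ω) + 3 • ev ![u, v, w] ω := by
  -- Closedness on `(eᵢ, u, v, w)`, solved for the derivative in direction `eᵢ`.
  have hclosed : ∀ i, lieDeriv b u (ev ![b i, v, w] ω) - lieDeriv b v (ev ![b i, u, w] ω) +
      lieDeriv b w (ev ![b i, u, v] ω) = pderiv K i (ev ![u, v, w] ω) := by
    intro i
    have h := ev_d_three b (b i) u v w ω
    rw [hω, map_zero, lieDeriv_basis] at h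
    rw [← sub_eq_zero, ← neg_eq_zero, h]
    abel
  have hadd : ∀ i (f g : Ser n K), coordMul i (f + g) = coordMul i f + coordMul i g :=
    fun i f g => act_add _ f g
  have hsub : ∀ i (f g : Ser n K), coordMul i (f - g) = coordMul i f - coordMul i g :=
    fun i f g => act_sub _ f g
  have h1 : ev ![v, u, w] ω = -ev ![u, v, w] ω := by
    funext α
    have h := (ω α).map_swap ![u, v, w] (i := 0) (j := 1) (by simp)
    refine Eq.trans ?_ h
    rw [ev_apply]
    congr 1
    ext i; fin_cases i <;> rfl
  have h2 : ev ![w, u, v] ω = ev ![u, v, w] ω := by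
    funext α
    have h := (ω α).map_swap ![u, v, w] (i := 0) (j := 1) (by simp)
    have h' := (ω α).map_swap (![u, v, w] ∘ Equiv.swap 0 1) (i := 0) (j := 2) (by simp)
    rw [h, neg_neg] at h'
    refine Eq.trans ?_ h'
    rw [ev_apply]
    congr 1
    ext i; fin_cases i <;> rfl
  rw [ev_d_two, ev_contractEuler, ev_contractEuler, ev_contractEuler, ← sum_coordMul_pderiv]
  simp only [← hclosed, hadd, hsub, map_sum, lieDeriv_coordMul, Finset.sum_add_distrib,
    Finset.sum_sub_distrib, sum_coord_smul_ev, h1, h2]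
  -- Each of the three derivatives in `d` hits the coordinate factor once and returns one copy of
  -- `ω`.
  rw [show (3 : ℕ) = 1 + 1 + 1 from rfl, add_smul, add_smul, one_smul]
  abel

/-- Multiply the part of degree `r` of a series by `c r`. -/
def scaleDegree {M : Type*} [AddCommGroup M] [Module K M] (c : ℕ → K) (f : Ser n M) : Ser n M :=
  fun α => c α.degree • f α

theorem scaleDegree_apply {M : Type*} [AddCommGroup M] [Module K M] (c : ℕ → K) (f : Ser n M)
    (α : Fin n →₀ ℕ) : scaleDegree c f α = c α.degree • f α := rfl

theorem lieDeriv_scaleDegree {M : Type*} [AddCommGroup M] [Module K M] (c : ℕ → K) (u : V)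
    (f : Ser n M) (α : Fin n →₀ ℕ) :
    lieDeriv b u (scaleDegree c f) α =
      c (α.degree + 1) • lieDeriv b u f α := by
  rw [lieDeriv_eq_sum, lieDeriv_eq_sum, sum_ser_apply, sum_ser_apply, Finset.smul_sum]
  refine Finset.sum_congr rfl fun i _ => ?_
  rw [smul_ser_apply, smul_ser_apply, pderiv_apply, pderiv_apply, scaleDegree_apply, map_add,
    Finsupp.degree_single, smul_comm (α i + 1), smul_comm (b.coord i u)]

/-- Contraction with the Euler field inverts `d` on closed forms up to the factor `r + 3` in
coefficient degree `r`, and rescaling degree by degree removes it. This also keeps `closedPairing`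
away from its default value 0. -/
theorem exists_polynomial_primitive [CharZero K] {ω : Form K V n 3 K} (hp : IsPolynomial ω)
    (hω : d b ω = 0) : ∃ ξ : Form K V n 2 K, IsPolynomial ξ ∧ d b ξ = ω := by
  -- The contraction raises the coefficient degree from `r` to `k = r + 1`, so `r + 3` is `k + 2`.
  let c : ℕ → K := fun k => ((k + 2 : ℕ) : K)⁻¹
  refine ⟨scaleDegree c (contractEuler b ω), ?_, ?_⟩
  · refine Set.Finite.subset (Set.finite_iUnion fun i : Fin n =>
      hp.image fun α => α + Finsupp.single i 1) fun α hα => ?_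
    by_contra hn
    refine hα ?_
    have h0 : contractEuler b ω α = 0 := by
      rw [contractEuler, sum_ser_apply]
      refine Finset.sum_eq_zero fun i _ => ?_
      rw [mono_act_apply]
      split_ifs with hi
      · have : ω (α - Finsupp.single i 1) = 0 := by
          by_contra hne
          exact hn (Set.mem_iUnion.2 ⟨i, _, hne, sub_single_add_single hi⟩)
        rw [contractLeft, this, one_smul]
        rfl
      · rfl
    rw [scaleDegree_apply, h0, smul_zero]
  · refine form_ext fun v => ?_
    rw [eq_vec3 v]
    funext α
    have h := congrFun (d_contractEuler b hω (v 0) (v 1) (v 2)) α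
    have hs : ∀ u v : V, ev ![u, v] (scaleDegree c (contractEuler b ω)) =
        scaleDegree c (ev ![u, v] (contractEuler b ω)) := fun _ _ => rfl
    rw [ev_d_two, add_ser_apply, sub_ser_apply] at h ⊢
    rw [hs, hs, hs, lieDeriv_scaleDegree, lieDeriv_scaleDegree, lieDeriv_scaleDegree, ← smul_sub, ← smul_add, h,
      add_ser_apply, euler_apply, nsmul_ser_apply, ← add_smul, ← Nat.cast_smul_eq_nsmul K,
      smul_smul]
    have h3 : ((α.degree + 3 : ℕ) : K) ≠ 0 := Nat.cast_ne_zero.2 (Nat.succ_ne_zero _)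
    have h4 : c (α.degree + 1) * ((α.degree + 3 : ℕ) : K) = 1 := inv_mul_cancel₀ h3
    rw [h4, one_smul]

theorem rhoHat_Kab [CharZero K] {ω : Form K V n 3 K} (hp : IsPolynomial ω) (hω : d b ω = 0) :
    rhoHat b (Kab b) ω = ω := by
  have h := exists_polynomial_primitive b hp hω
  rw [rhoHat, closedPairing, dif_pos h]
  exact (mapForm_pairing_Kab b h.choose).trans h.choose_spec.2

end Poincare

/-! ### The explicit formula for the 2-curvature -/

section Multiplicities

variable {n : ℕ}

/-- The exponent vector of a list of indices. -/
def multiplicity (q : List (Fin n)) : Fin n →₀ ℕ :=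
  Finsupp.equivFunOnFinite.symm fun s => q.count s

theorem multiplicity_apply (q : List (Fin n)) (s : Fin n) : multiplicity q s = q.count s := rfl

theorem multiplicity_cons (i : Fin n) (q : List (Fin n)) :
    multiplicity (i :: q) = multiplicity q + Finsupp.single i 1 := by
  ext s
  rw [Finsupp.add_apply, multiplicity_apply, multiplicity_apply, List.count_cons,
    Finsupp.single_apply]
  simp only [beq_iff_eq]

theorem multiplicity_eq_iff {q q' : List (Fin n)} :
    multiplicity q = multiplicity q' ↔ q.Perm q' := by
  rw [List.perm_iff_count, DFunLike.ext_iff]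
  rfl

theorem degree_multiplicity (q : List (Fin n)) : (multiplicity q).degree = q.length := by
  induction q with
  | nil => exact (Finsupp.degree_eq_zero_iff _).2 (by ext s; rfl)
  | cons i q ih => rw [multiplicity_cons, map_add, ih, Finsupp.degree_single, List.length_cons]

theorem exists_multiplicity_eq (α : Fin n →₀ ℕ) : ∃ q : List (Fin n), multiplicity q = α := by
  refine ⟨(Finsupp.toMultiset α).toList, ?_⟩
  ext s
  rw [multiplicity_apply, ← Multiset.coe_count, Multiset.coe_toList, Finsupp.count_toMultiset]

/-- The multifactorial `α!`. -/
def multifactorial (α : Fin n →₀ ℕ) : ℕ := ∏ s, (α s).factorial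

theorem multifactorial_add_single (α : Fin n →₀ ℕ) (i : Fin n) :
    multifactorial (α + Finsupp.single i 1) = (α i + 1) * multifactorial α := by
  rw [multifactorial, multifactorial, ← Finset.mul_prod_erase _ _ (Finset.mem_univ i),
    ← Finset.mul_prod_erase _ (fun s => (α s).factorial) (Finset.mem_univ i), ← mul_assoc]
  congr 1
  · simp [Nat.factorial_succ]
  · refine Finset.prod_congr rfl fun s hs => ?_
    have : i ≠ s := (Finset.ne_of_mem_erase hs).symm
    simp [this]

theorem multifactorial_ne_zero (α : Fin n →₀ ℕ) : multifactorial α ≠ 0 :=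
  Finset.prod_ne_zero_iff.2 fun _ _ => Nat.factorial_ne_zero _

end Multiplicities

/-! ### The commutative action of the tensor algebra on `𝔞₁` -/

section CommutingAction

variable {K V : Type*} [Field K] [AddCommGroup V] [Module K V] {n : ℕ}
variable (b : Module.Basis (Fin n) K V)

/-- The iterated bracket `[e_{q₁}, … [e_{q_r}, X] … ]`. -/
def iterBracket (q : List (Fin n)) (X : K1 K V) : K1 K V :=
  q.foldr (fun s X => TensorAlgebra.ι K (b s) • X) X

theorem iterBracket_cons (i : Fin n) (q : List (Fin n)) (X : K1 K V) :
    iterBracket b (i :: q) X = TensorAlgebra.ι K (b i) • iterBracket b q X := rfl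

theorem iterBracket_mem (q : List (Fin n)) {X : K1 K V} (hX : X ∈ A1 K V) :
    iterBracket b q X ∈ A1 K V := by
  induction q with
  | nil => exact hX
  | cons i q ih => exact smul_mem_A1 _ ih

theorem iterBracket_perm {q q' : List (Fin n)} (h : q.Perm q') {X : K1 K V} (hX : X ∈ A1 K V) :
    iterBracket b q X = iterBracket b q' X := by
  induction h with
  | nil => rfl
  | cons i _ ih => rw [iterBracket_cons, iterBracket_cons, ih]
  | swap i j q =>
    rw [iterBracket_cons, iterBracket_cons, iterBracket_cons, iterBracket_cons]
    exact ι_smul_comm (iterBracket_mem b q hX) _ _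
  | trans _ _ ih1 ih2 => exact ih1.trans ih2

theorem iterBracket_cons' (i : Fin n) (q : List (Fin n)) {X : K1 K V} (hX : X ∈ A1 K V) :
    iterBracket b (i :: q) X = iterBracket b q (TensorAlgebra.ι K (b i) • X) := by
  have h : (i :: q).Perm (q ++ [i]) := (List.perm_append_singleton i q).symm
  rw [iterBracket_perm b h hX, iterBracket, List.foldr_append]
  rfl

theorem iterBracket_add (q : List (Fin n)) (X Y : K1 K V) :
    iterBracket b q (X + Y) = iterBracket b q X + iterBracket b q Y := by
  induction q with
  | nil => rfl
  | cons i q ih => rw [iterBracket_cons, ih, smul_add]; rfl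

theorem iterBracket_sub (q : List (Fin n)) (X Y : K1 K V) :
    iterBracket b q (X - Y) = iterBracket b q X - iterBracket b q Y := by
  rw [eq_sub_iff_add_eq, ← iterBracket_add, sub_add_cancel]

/-- On `𝔞₁` the coefficients of `θ` act through the commutative monomials. -/
theorem multifactorial_smul_theta [CharZero K] (q : List (Fin n)) {X : K1 K V}
    (hX : X ∈ A1 K V) :
    multifactorial (multiplicity q) • theta b (multiplicity q) • X = iterBracket b q X := by
  suffices h : ∀ r, ∀ q : List (Fin n), q.length = r →
      multifactorial (multiplicity q) • theta b (multiplicity q) • X = iterBracket b q X from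
    h _ q rfl
  intro r
  induction r with
  | zero =>
    intro q hq
    obtain rfl := List.length_eq_zero_iff.1 hq
    have h0 : multiplicity ([] : List (Fin n)) = 0 := by ext s; rfl
    rw [h0, theta_zero, one_smul, multifactorial]
    simp [iterBracket]
  | succ r ih =>
    intro q hq
    -- The recursion for `θ` removes one occurrence of each `i` in `q`. The `i`-th summand becomes
    -- the count of `i` times the full bracket, and the counts add up to the length.
    have key : (multiplicity q).degree •
        (multifactorial (multiplicity q) • theta b (multiplicity q) • X) =
          (multiplicity q).degree • iterBracket b q X := by
      rw [smul_comm, ← smul_assoc (multiplicity q).degree, degree_smul_theta, Finset.sum_smul,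
        degree_eq_sum, Finset.sum_smul, Finset.smul_sum]
      refine Finset.sum_congr rfl fun i _ => ?_
      split_ifs with hi
      · have hmem : i ∈ q := List.count_pos_iff.1 hi
        have hp : q.Perm (i :: q.erase i) := List.perm_cons_erase hmem
        have hm : multiplicity q = multiplicity (q.erase i) + Finsupp.single i 1 := by
          rw [multiplicity_eq_iff.2 hp, multiplicity_cons]
        have hl : (q.erase i).length = r := by
          rw [List.length_erase_of_mem hmem, hq, Nat.add_sub_cancel]
        rw [iterBracket_perm b hp hX, iterBracket_cons, ← ih _ hl, hm, add_tsub_cancel_right,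
          multifactorial_add_single, mul_smul, mul_smul,
          smul_comm (multifactorial (multiplicity (q.erase i))) (TensorAlgebra.ι K (b i))]
        simp
      · rw [Nat.eq_zero_of_not_pos hi, zero_smul, zero_smul, smul_zero]
    have hd : (((multiplicity q).degree : ℕ) : K) ≠ 0 := by
      rw [degree_multiplicity, hq]
      exact Nat.cast_ne_zero.2 (Nat.succ_ne_zero r)
    rw [← Nat.cast_smul_eq_nsmul K, ← Nat.cast_smul_eq_nsmul K] at key
    exact smul_right_injective (K1 K V) hd key

/-- The identity `ζ₀ ∧ ζ₀ ∧ ζ₁ = 0`. -/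
theorem smul_wedgeUniversal (t u v w : V) :
    TensorAlgebra.ι K t • (wedgeUniversal u v w : K1 K V) =
      TensorAlgebra.ι K u • wedgeUniversal t v w - TensorAlgebra.ι K v • wedgeUniversal t u w +
        TensorAlgebra.ι K w • wedgeUniversal t u v := by
  -- The Peiffer identity for two generators, `[t, u] ▷ (v ∧ w) + [v, w] ▷ (t ∧ u) = 0`. The claim
  -- is the signed sum over the three ways to split four vectors into pairs.
  have h : ∀ t u v w : V,
      (TensorAlgebra.ι K t • TensorAlgebra.ι K u • (gen ![v, w] : K1 K V) -
        TensorAlgebra.ι K u • TensorAlgebra.ι K t • gen ![v, w]) +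
      (TensorAlgebra.ι K v • TensorAlgebra.ι K w • gen ![t, u] -
        TensorAlgebra.ι K w • TensorAlgebra.ι K v • gen ![t, u]) = 0 := by
    intro t u v w
    have := deltaT_smul_eq_neg (gen ![t, u] : K1 K V) (gen ![v, w])
    rw [deltaT_gen, deltaT_gen, sub_smul, sub_smul, mul_smul, mul_smul, mul_smul, mul_smul] at this
    rw [this, neg_add_cancel]
  have h1 := h t u v w
  have h2 := h t v u w
  have h3 := h t w u v
  rw [← sub_eq_zero]
  simp only [wedgeUniversal, smul_add, smul_sub]
  refine Eq.trans ?_ (congrArg₂ (· + ·) (congrArg₂ (· - ·) h1 h2) h3 |>.trans (by simp))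
  abel

end CommutingAction

/-! ### Indexing by exponent vectors and comparison of coefficients -/

section ExplicitFormula

variable {K V : Type*} [Field K] [AddCommGroup V] [Module K V] {n : ℕ}
variable (b : Module.Basis (Fin n) K V)

/-- The exponent vector `α` of `ω_{q,ijk}`. -/
def Index.exponent (p : Index n) : Fin n →₀ ℕ := multiplicity (p.1.1 ++ [p.1.2.1])

theorem Index.exponent_eq (p : Index n) :
    p.exponent = multiplicity p.1.1 + Finsupp.single p.1.2.1 1 := by
  rw [← multiplicity_cons, Index.exponent, multiplicity_eq_iff]
  exact List.perm_append_singleton _ _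

theorem Index.degree_exponent (p : Index n) : p.exponent.degree = p.1.1.length + 1 := by
  rw [Index.exponent, degree_multiplicity, List.length_append, List.length_singleton]

theorem Index.finite_degree (r : ℕ) : {p : Index n | p.exponent.degree = r}.Finite := by
  have h : ((fun p : Index n => p.1) '' {p | p.exponent.degree = r}).Finite := by
    refine Set.Finite.subset ((List.finite_length_le (Fin n) r).prod Set.finite_univ) ?_
    rintro _ ⟨p, hp, rfl⟩
    rw [Set.mem_ofPred_eq, p.degree_exponent] at hp
    refine ⟨?_, Set.mem_univ _⟩
    simp only [Set.mem_ofPred_eq]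
    omega
  exact h.of_finite_image Subtype.val_injective.injOn

/-- The list `(q, i)` is weakly decreasing, hence determined by its multiplicities, and `i` is its
last entry. -/
theorem Index.ext_of_exponent {p p' : Index n} (h : p.exponent = p'.exponent)
    (hj : p.1.2.2 = p'.1.2.2) : p = p' := by
  have hl : p.1.1 ++ [p.1.2.1] = p'.1.1 ++ [p'.1.2.1] :=
    (multiplicity_eq_iff.1 h).eq_of_pairwise (fun _ _ _ _ h1 h2 => le_antisymm h2 h1) p.2.1 p'.2.1
  obtain ⟨h1, h2⟩ := List.append_inj' hl rfl
  exact Subtype.ext (Prod.ext h1 (Prod.ext (List.singleton_inj.1 h2) hj))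

/-- The element `B_{q,ijk}` if the index has exponent vector `γ` and `j = x`, `k = y`, else `0`. -/
def indexTerm (γ : Fin n →₀ ℕ) (x y : Fin n) (p : Index n) : K1 K V :=
  if p.exponent = γ ∧ p.1.2.2.1 = x ∧ p.1.2.2.2 = y then
    Bq b p.1.1 p.1.2.1 p.1.2.2.1 p.1.2.2.2 else 0

theorem finite_support_indexTerm (γ : Fin n →₀ ℕ) (x y : Fin n) :
    (Function.support (indexTerm b γ x y)).Finite := by
  refine (Index.finite_degree γ.degree).subset fun p hp => ?_
  by_contra hn
  refine hp (if_neg fun h => hn ?_)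
  rw [Set.mem_ofPred_eq, h.1]

/-- An index with this exponent would have its `i` in the support of `γ` and also `i < j = x`. -/
theorem finsum_indexTerm_eq_zero {γ : Fin n →₀ ℕ} {x : Fin n} (y : Fin n)
    (h : ∀ s, γ s ≠ 0 → x ≤ s) : ∑ᶠ p, indexTerm b γ x y p = 0 := by
  refine finsum_eq_zero_of_forall_eq_zero fun p => if_neg fun hp => ?_
  have h1 : γ p.1.2.1 ≠ 0 := by
    rw [← hp.1, p.exponent_eq]
    simp
  have h2 := h _ h1
  have h3 := p.2.2.1
  rw [hp.2.1] at h3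
  exact absurd h3 h2.not_gt

/-- Exactly one index contributes: `L` sorted decreasingly, followed by its lower bound `i`. Sorting
does not change the bracket on `𝔞₁`. -/
theorem finsum_indexTerm_of_lt {L : List (Fin n)} {i x y : Fin n} (hL : ∀ s ∈ L, i ≤ s)
    (hix : i < x) (hxy : x < y) :
    ∑ᶠ p, indexTerm b (multiplicity (i :: L)) x y p =
      iterBracket b L (wedgeUniversal (b i) (b x) (b y)) := by
  have hperm : (L.mergeSort (fun s t => decide (t ≤ s))).Perm L := List.mergeSort_perm _ _
  have hsort : (L.mergeSort (fun s t => decide (t ≤ s))).Pairwise (· ≥ ·) := by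
    have := List.pairwise_mergeSort (le := fun s t : Fin n => decide (t ≤ s))
      (fun a b c h1 h2 => by simp only [decide_eq_true_eq] at *; exact h2.trans h1)
      (fun a b => by simpa using le_total b a) L
    simpa using this
  have hpw : (L.mergeSort (fun s t => decide (t ≤ s)) ++ [i]).Pairwise (· ≥ ·) := by
    refine List.pairwise_append.2 ⟨hsort, List.pairwise_singleton _ _, fun s hs t ht => ?_⟩
    rw [List.mem_singleton.1 ht]
    exact hL s (hperm.mem_iff.1 hs)
  let p₀ : Index n := ⟨(L.mergeSort (fun s t => decide (t ≤ s)), i, x, y), hpw, hix, hxy⟩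
  have h0 : p₀.exponent = multiplicity (i :: L) :=
    multiplicity_eq_iff.2 ((List.perm_append_singleton _ _).trans (hperm.cons i))
  rw [finsum_eq_single _ p₀]
  · rw [indexTerm, if_pos ⟨h0, rfl, rfl⟩]
    exact iterBracket_perm b hperm (wedgeUniversal_mem _ _ _)
  · intro p hp
    refine if_neg fun h => hp ?_
    exact Index.ext_of_exponent (h.1.trans h0.symm) (Prod.ext h.2.1 h.2.2)

/-- The expansion of `α! θ_α ▷ B_{xyz}` in the elements `B_{q,ijk}`. -/
theorem multifactorial_smul_theta_wedgeUniversal [CharZero K] (β : Fin n →₀ ℕ) {x y z : Fin n}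
    (hxy : x < y) (hyz : y < z) :
    multifactorial β • theta b β • (wedgeUniversal (b x) (b y) (b z) : K1 K V) =
      ∑ᶠ p, indexTerm b (β + Finsupp.single x 1) y z p -
        ∑ᶠ p, indexTerm b (β + Finsupp.single y 1) x z p +
          ∑ᶠ p, indexTerm b (β + Finsupp.single z 1) x y p := by
  obtain ⟨L, rfl⟩ := exists_multiplicity_eq β
  rw [multifactorial_smul_theta b L (wedgeUniversal_mem _ _ _), ← multiplicity_cons,
    ← multiplicity_cons, ← multiplicity_cons]
  have hcount : ∀ (q : List (Fin n)) s, multiplicity q s ≠ 0 ↔ s ∈ q := fun q s => by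
    rw [multiplicity_apply, ← Nat.pos_iff_ne_zero, List.count_pos_iff]
  -- If no entry of `L` lies below `x`, the left side is already a single `B_{q,xyz}`, and the other
  -- two sums are empty because they have `j = x`.
  by_cases hL : ∀ s ∈ L, x ≤ s
  · rw [finsum_indexTerm_of_lt b hL hxy hyz, finsum_indexTerm_eq_zero, finsum_indexTerm_eq_zero,
      sub_zero, add_zero]
    · intro s hs
      rcases List.mem_cons.1 ((hcount _ _).1 hs) with rfl | h
      exacts [(hxy.trans hyz).le, hL s h]
    · intro s hs
      rcases List.mem_cons.1 ((hcount _ _).1 hs) with rfl | h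
      exacts [hxy.le, hL s h]
  -- Otherwise the minimal entry `i < x` is moved innermost, and `ζ₀ ∧ ζ₀ ∧ ζ₁ = 0` rewrites `eᵢ ▷
  -- B_{xyz}` through `B_{iyz}`, `B_{ixz}` and `B_{ixy}`, one for each sum.
  · obtain ⟨s, hs, hsx⟩ : ∃ s ∈ L, s < x := by simpa using hL
    obtain ⟨i, hi, hmin⟩ : ∃ i ∈ L, ∀ s ∈ L, i ≤ s := by
      have hne : L.toFinset.Nonempty := ⟨s, List.mem_toFinset.2 hs⟩
      obtain ⟨i, hi, h⟩ := L.toFinset.exists_min_image id hne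
      exact ⟨i, List.mem_toFinset.1 hi, fun s hs => h s (List.mem_toFinset.2 hs)⟩
    have hix : i < x := (hmin s hs).trans_lt hsx
    have hp : L.Perm (i :: L.erase i) := List.perm_cons_erase hi
    have hle : ∀ t, i < t → ∀ s ∈ t :: L.erase i, i ≤ s := by
      intro t ht s hs
      rcases List.mem_cons.1 hs with rfl | h
      exacts [ht.le, hmin s (List.mem_of_mem_erase h)]
    have hm : ∀ t, multiplicity (t :: L) = multiplicity (i :: t :: L.erase i) := fun t =>
      multiplicity_eq_iff.2 ((hp.cons t).trans (List.Perm.swap _ _ _))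
    have hiy := hix.trans hxy
    rw [hm, hm, hm, finsum_indexTerm_of_lt b (hle x hix) hiy hyz,
      finsum_indexTerm_of_lt b (hle y hiy) hix (hxy.trans hyz),
      finsum_indexTerm_of_lt b (hle z (hiy.trans hyz)) hix hxy,
      iterBracket_perm b hp (wedgeUniversal_mem _ _ _),
      iterBracket_cons' b _ _ (wedgeUniversal_mem _ _ _),
      iterBracket_cons' b _ _ (wedgeUniversal_mem _ _ _),
      iterBracket_cons' b _ _ (wedgeUniversal_mem _ _ _),
      iterBracket_cons' b _ _ (wedgeUniversal_mem _ _ _), smul_wedgeUniversal, iterBracket_add,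
      iterBracket_sub]

theorem omegaq_eq (p : Index n) : omegaq b p.1.1 p.1.2.1 p.1.2.2.1 p.1.2.2.2 =
    mono p.exponent (((multifactorial p.exponent : ℕ) : K)⁻¹ •
      constWedge (dz b p.1.2.2.1) (dz b p.1.2.2.2)) := rfl

theorem constWedge_dz_apply {j k x y : Fin n} (hjk : j < k) (hxy : x < y) :
    constWedge (dz b j) (dz b k) ![b x, b y] = if j = x ∧ k = y then 1 else 0 := by
  have h : ∀ i l, dz b i (fun _ => b l) = if i = l then 1 else 0 := by
    intro i l
    change b.coord i (b l) = _
    rw [Module.Basis.coord_apply, b.repr_self, Finsupp.single_apply]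
    simp only [eq_comm]
  rw [constWedge_apply_pair, h, h, h, h]
  have : ¬(j = y ∧ k = x) := by
    rintro ⟨rfl, rfl⟩
    exact absurd hjk hxy.not_gt
  by_cases h1 : j = x <;> by_cases h2 : k = y <;> by_cases h3 : j = y <;> by_cases h4 : k = x <;>
    simp_all

/-- The factor `β!` clears all denominators, since `β! (βᵢ + 1) = (β + eᵢ)!`. -/
theorem multifactorial_mul_pderiv_omegaq [CharZero K] (β : Fin n →₀ ℕ) {x y : Fin n} (hxy : x < y)
    (i : Fin n) (p : Index n) :
    (multifactorial β : K) *
      pderiv K i (ev ![b x, b y] (omegaq b p.1.1 p.1.2.1 p.1.2.2.1 p.1.2.2.2)) β =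
        if p.exponent = β + Finsupp.single i 1 ∧ p.1.2.2.1 = x ∧ p.1.2.2.2 = y then 1 else 0 := by
  rw [omegaq_eq, ev_mono, pderiv_apply, mono, AlternatingMap.smul_apply,
    constWedge_dz_apply b p.2.2.2 hxy]
  by_cases h : p.exponent = β + Finsupp.single i 1
  · rw [if_pos h.symm, h, multifactorial_add_single]
    have h1 : (multifactorial β : K) ≠ 0 := Nat.cast_ne_zero.2 (multifactorial_ne_zero β)
    have h2 : ((β i + 1 : ℕ) : K) ≠ 0 := Nat.cast_ne_zero.2 (Nat.succ_ne_zero _)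
    rw [nsmul_eq_mul, Nat.cast_mul, mul_inv, smul_eq_mul, mul_assoc, mul_inv_cancel_left₀ h2,
      mul_inv_cancel_left₀ h1]
    simp
  · rw [if_neg (Ne.symm h), smul_zero, mul_zero, if_neg fun h' => h h'.1]

theorem d_omegaq_eq_zero (β : Fin n →₀ ℕ) (p : Index n) (h : p.exponent.degree ≠ β.degree + 1) :
    d b (omegaq b p.1.1 p.1.2.1 p.1.2.2.1 p.1.2.2.2) β = 0 := by
  refine AlternatingMap.ext fun v => ?_
  rw [← ev_apply, ev_d, sum_ser_apply]
  refine Finset.sum_eq_zero fun i _ => ?_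
  refine (congrArg ((-1 : ℤ) ^ (i : ℕ) • ·) ?_).trans (smul_zero _)
  rw [lieDeriv_eq_sum, sum_ser_apply]
  refine Finset.sum_eq_zero fun j _ => ?_
  rw [smul_ser_apply, pderiv_apply, omegaq_eq, ev_mono, mono, if_neg, smul_zero, smul_zero]
  intro h'
  refine h ?_
  rw [← h', map_add, Finsupp.degree_single]

theorem finite_term (β : Fin n →₀ ℕ) : {p : Index n | term b p β ≠ 0}.Finite := by
  refine (Index.finite_degree (β.degree + 1)).subset fun p hp => ?_
  by_contra h
  refine hp ?_
  rw [term, tensorForm, mapForm, d_omegaq_eq_zero b β p h]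
  exact AlternatingMap.ext fun v =>
    zero_smul K (Bq b p.1.1 p.1.2.1 p.1.2.2.1 p.1.2.2.2)

/-- Alternating maps that agree on strictly increasing tuples of basis vectors are equal. -/
theorem ext_alternating_of_strictMono {M : Type*} [AddCommGroup M] [Module K M] {m : ℕ}
    {f g : V [⋀^Fin m]→ₗ[K] M}
    (h : ∀ v : Fin m → Fin n, StrictMono v → (f fun i => b (v i)) = g fun i => b (v i)) :
    f = g := by
  refine b.ext_alternating fun v hv => ?_
  have h1 := h (v ∘ Tuple.sort v) ((Tuple.monotone_sort v).strictMono_of_injective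
    (hv.comp (Tuple.sort v).injective))
  have hf := f.map_perm (fun i => b (v i)) (Tuple.sort v)
  have hg := g.map_perm (fun i => b (v i)) (Tuple.sort v)
  have h2 : Equiv.Perm.sign (Tuple.sort v) • f (fun i => b (v i)) =
      Equiv.Perm.sign (Tuple.sort v) • g fun i => b (v i) := hf.symm.trans (h1.trans hg)
  exact (smul_left_cancel_iff _).1 h2

theorem ite_sub_ite_add_ite_smul {M : Type*} [AddCommGroup M] [Module K M] (P Q R : Prop)
    [Decidable P] [Decidable Q] [Decidable R] (x : M) :
    (((if P then 1 else 0) - (if Q then 1 else 0) + (if R then 1 else 0) : K)) • x =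
      (if P then x else 0) - (if Q then x else 0) + (if R then x else 0) := by
  simp only [add_smul, sub_smul, ite_smul, one_smul, zero_smul]

theorem multifactorial_smul_term_apply [CharZero K] (β : Fin n →₀ ℕ) {x y z : Fin n} (hxy : x < y)
    (hyz : y < z) (p : Index n) :
    multifactorial β • term b p β ![b x, b y, b z] =
      indexTerm b (β + Finsupp.single x 1) y z p - indexTerm b (β + Finsupp.single y 1) x z p +
        indexTerm b (β + Finsupp.single z 1) x y p := by
  rw [← ev_apply, term, ev_tensorForm_apply, ← Nat.cast_smul_eq_nsmul K, smul_smul, ev_d_two,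
    add_ser_apply, sub_ser_apply, mul_add, mul_sub, lieDeriv_basis, lieDeriv_basis, lieDeriv_basis,
    multifactorial_mul_pderiv_omegaq b β hyz, multifactorial_mul_pderiv_omegaq b β (hxy.trans hyz),
    multifactorial_mul_pderiv_omegaq b β hxy]
  exact ite_sub_ite_add_ite_smul _ _ _ _

/-- On an increasing basis triple, `β!` times either side is the same signed combination of three
sums of `indexTerm`; in characteristic 0 the factor `β!` cancels. -/
theorem Kab_eq_finsum [CharZero K] (β : Fin n →₀ ℕ) : Kab b β = ∑ᶠ p, term b p β := by
  refine ext_alternating_of_strictMono b fun v hv => ?_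
  have h01 : v 0 < v 1 := hv (by simp)
  have h12 : v 1 < v 2 := hv (by simp)
  rw [eq_vec3 fun i => b (v i)]
  have hsum : (∑ᶠ p, term b p β) ![b (v 0), b (v 1), b (v 2)] =
      ∑ᶠ p, term b p β ![b (v 0), b (v 1), b (v 2)] :=
    (evalAt (K := K) ![b (v 0), b (v 1), b (v 2)]).toAddMonoidHom.map_finsum (finite_term b β)
  -- A `finsum` with infinite support is 0 by convention, so finiteness has to be known before
  -- scalars and sums may be moved through it.
  have hfin : (Function.support fun p => term b p β ![b (v 0), b (v 1), b (v 2)]).Finite := by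
    refine (finite_term b β).subset fun p hp h0 => hp ?_
    change term b p β ![b (v 0), b (v 1), b (v 2)] = 0
    rw [h0]
    rfl
  have hf := fun γ x y => finite_support_indexTerm b γ x y
  have key : multifactorial β • Kab b β ![b (v 0), b (v 1), b (v 2)] =
      multifactorial β • ∑ᶠ p, term b p β ![b (v 0), b (v 1), b (v 2)] := by
    rw [Kab_apply, multifactorial_smul_theta_wedgeUniversal b β h01 h12, smul_finsum' _ hfin]
    simp only [multifactorial_smul_term_apply b β h01 h12]
    rw [finsum_add_distrib, finsum_sub_distrib (hf _ _ _) (hf _ _ _)]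
    · exact ((hf _ _ _).union (hf _ _ _)).subset (Function.support_sub _ _)
    · exact hf _ _ _
  rw [hsum]
  rw [← Nat.cast_smul_eq_nsmul K, ← Nat.cast_smul_eq_nsmul K] at key
  exact smul_right_injective (K1 K V)
    (Nat.cast_ne_zero.2 (multifactorial_ne_zero β) : (multifactorial β : K) ≠ 0) key

end ExplicitFormula

end UniversalTwoConnection

end

theorem mainTheorem10 {K V : Type*} [Field K] [CharZero K] [AddCommGroup V] [Module K V] {n : ℕ}
    (b : Module.Basis (Fin n) K V) :
    -- the gauge transformation abelianizes: `(θ, Θ) · ζ₀ = 0` and `ζ₁^ab` has values in `𝔞₁`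
    (UniversalTwoConnection.abelianized b).1 = 0 ∧
    (∀ α v, (UniversalTwoConnection.abelianized b).2 α v ∈ UniversalTwoConnection.A1 K V) ∧
    -- `𝒦^ab` is a closed form with values in `𝔞₁`
    (∀ α v, UniversalTwoConnection.Kab b α v ∈ UniversalTwoConnection.A1 K V) ∧
    UniversalTwoConnection.d b (UniversalTwoConnection.Kab b) = 0 ∧
    -- `ρ̂(𝒦^ab)` is the identity of the closed polynomial `3`-forms
    (∀ ω : UniversalTwoConnection.Form K V n 3 K, UniversalTwoConnection.IsPolynomial ω →
      UniversalTwoConnection.d b ω = 0 →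
      UniversalTwoConnection.rhoHat b (UniversalTwoConnection.Kab b) ω = ω) ∧
    -- the same, for an arbitrary polynomial primitive `ξ` of the closed form `ω = dξ`
    (∀ ξ : UniversalTwoConnection.Form K V n 2 K, UniversalTwoConnection.IsPolynomial ξ →
      UniversalTwoConnection.mapForm
        (-UniversalTwoConnection.pairing b ξ ∘ₗ UniversalTwoConnection.rho)
        (UniversalTwoConnection.Kab b) = UniversalTwoConnection.d b ξ) ∧
    -- `𝒦^ab = ∑ B_{q,ijk} ⊗ d(ω_{q,ijk})`, a sum that is finite in each coefficient
    (∀ α, {p | UniversalTwoConnection.term b p α ≠ 0}.Finite ∧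
      UniversalTwoConnection.Kab b α = ∑ᶠ p, UniversalTwoConnection.term b p α) := by
  refine ⟨UniversalTwoConnection.abelianized_fst b, UniversalTwoConnection.abelianized_snd_mem b,
    UniversalTwoConnection.Kab_mem b, UniversalTwoConnection.d_Kab b,
    fun ω => UniversalTwoConnection.rhoHat_Kab b,
    fun ξ _ => UniversalTwoConnection.mapForm_pairing_Kab b ξ,
    fun α => ⟨UniversalTwoConnection.finite_term b α, UniversalTwoConnection.Kab_eq_finsum b α⟩⟩
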